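/- For $\mathbf{x},\mathbf{y}\in\mathbb{R}^n$ let $$\rho_{\mathbf{x},\mathbf{y}}=\frac{\sum_{i=1}^n(x_i-\bar x)(y_i-\bar y)}{\sqrt{\sum_{i=1}^n(x_i-\bar x)^2\cdot\sum_{i=1}^n(y_i-\bar y)^2}},\qquad \bar x=\frac1n\sum_{i=1}^n x_i,\quad \bar y=\frac1n\sum_{i=1}^n y_i,$$ be the Pearson correlation coefficient. A random vector $\mathbf{Y}$ in $\mathbb{R}^n$ is called spherical if $\mathbf{O}\mathbf{Y}$ and $\mathbf{Y}$ have the same distribution for every $n\times n$ orthogonal matrix $\mathbf{O}$. Let $p=p_n$ be a sequence of natural numbers with $(\log p)/n\to\beta\in(0,\infty)$ as $n\to\infty$. For every $n\ge 1$ let $\mathbf{X}_1,\dots,\mathbf{X}_p$ (the columns of an $n\times p$ random matrix) be independent random vectors in $\mathbb{R}^n$ with a common spherical distribution, which may depend on $n$, such that $P(\mathbf{X}_1=\mathbf{0})=0$. Let $\rho_{ij}$ be the Pearson correlation coefficient of $\mathbf{X}_i$ and $\mathbf{X}_j$, and let $L_n=\max_{1\le i<j\le p}|\rho_{ij}|$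 be the coherence of the matrix. Then: (i) $L_n\to\sqrt{1-e^{-4\beta}}$ in probability as $n\to\infty$. (ii) With $T_n=\log(1-L_n^2)$, the random variable $nT_n+4\log p-\log\log p$ converges weakly, as $n\to\infty$, to the probability distribution on $\mathbb{R}$ with distribution function $$F(y)=1-\exp\left\{-K(\beta)\,e^{(y+8\beta)/2}\right\},\quad y\in\mathbb{R},\qquad\text{where } K(\beta)=\left(\frac{\beta}{2\pi(1-e^{-4\beta})}\right)^{1/2}.$$ -/

import Mathlib

open MeasureTheory ProbabilityTheory Filter Topology
open scoped Matrix

/-- The sample mean `(1 / n) * ∑ i, x i` of a vector `x ∈ ℝⁿ`. -/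
noncomputable def sampleMean {n : ℕ} (x : Fin n → ℝ) : ℝ :=
  (∑ i, x i) / n

/-- The Pearson correlation coefficient of two vectors `x, y ∈ ℝⁿ`. -/
noncomputable def pearson {n : ℕ} (x y : Fin n → ℝ) : ℝ :=
  (∑ i, (x i - sampleMean x) * (y i - sampleMean y)) /
    √((∑ i, (x i - sampleMean x) ^ 2) * ∑ i, (y i - sampleMean y) ^ 2)

/-- The coherence of the `n × p` matrix whose columns are `x 0, …, x (p - 1)`: the maximum over
all pairs `i < j` of the absolute value of the Pearson correlation of columns `i` and `j`.
(For `p ≤ 1` there is no such pair, and the value is `0`.) -/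
noncomputable def coherence {n p : ℕ} (x : Fin p → Fin n → ℝ) : ℝ :=
  ⨆ q : {q : Fin p × Fin p // q.1 < q.2}, |pearson (x q.1.1) (x q.1.2)|

/-- A random vector `Y` in `ℝⁿ` is spherical if `O Y` and `Y` have the same law for every
`n × n` orthogonal matrix `O`. -/
def IsSpherical {Ω : Type*} [MeasurableSpace Ω] (μ : Measure Ω) {n : ℕ}
    (Y : Ω → Fin n → ℝ) : Prop :=
  ∀ O ∈ Matrix.orthogonalGroup (Fin n) ℝ, μ.map (fun ω => O *ᵥ Y ω) = μ.map Y

/-- The random vectors `X 0, …, X (p - 1)` in `ℝⁿ`, the columns of an `n × p` random matrix, are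
independent with a common spherical distribution that has no mass at the origin. -/
structure HasSphericalColumns {Ω : Type*} [MeasurableSpace Ω] (μ : Measure Ω) {n p : ℕ}
    (X : Fin p → Ω → Fin n → ℝ) : Prop where
  measurable : ∀ j, Measurable (X j)
  indep : iIndepFun X μ
  identDistrib : ∀ i j, IdentDistrib (X i) (X j) μ μ
  spherical : ∀ j, IsSpherical μ (X j)
  ne_zero : ∀ j, μ {ω | X j ω = 0} = 0

/-- Convergence in probability to a constant `c` of real random variables `Y n`, where `Y n` may
live on its own probability space `(Ω n, μ n)`. -/
def TendstoInProbability {Ω : ℕ → Type*} [∀ n, MeasurableSpace (Ω n)]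
    (μ : ∀ n, Measure (Ω n)) (Y : ∀ n, Ω n → ℝ) (c : ℝ) : Prop :=
  ∀ ε : ℝ, 0 < ε → Tendsto (fun n => μ n {ω | ε ≤ |Y n ω - c|}) atTop (𝓝 0)

/-! The Pearson correlation is the cosine of the angle between two vectors projected onto the
hyperplane orthogonal to the constants, which has dimension n - 1. Given one column, sphericity of
the other makes the probability of |ρ| ≥ t a spherical cap probability q = `capProb (n - 1) t`,
whatever the given column is (`measure_cap_of_rotation_invariant`). So all pair events have
probability q, and events of two distinct pairs sharing a column have joint probability q²
(`HasSphericalColumns.measure_two_pairs`).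

Pairs without a common column are independent, so the Chen–Stein bound
`abs_measureReal_none_sub_exp_le` gives P(L < t) = exp(-p(p - 1)q/2) up to an error 4p³q².

The cap probability is a quotient of tails of ∫ (1 + b²)^(-(n - 1)/2) db: explicit antiderivatives
control the numerator, a Gaussian limit the denominator. At `threshold p y n` this makes p²q/2
converge to K(β) e^{(y + 8β)/2} (`tendsto_sq_mul_capProb_threshold`). The error is then of order
1/p, and (ii) follows by convergence of distribution functions. For (i), the thresholds for all y
tend to the same √(1 - e^{-4β}), so two suitable values of y trap L near it. -/

/-! ### Chen–Stein bound for the Poisson probability of zero -/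

/-- The solution `∫₀¹ exp (-r s) s ^ k ds` of the Stein equation for the Poisson law of
parameter `r` and the set `{0}`. -/
noncomputable def steinZero (r : ℝ) (k : ℕ) : ℝ :=
  ∫ s in (0 : ℝ)..1, Real.exp (-(r * s)) * s ^ k

lemma steinZero_nonneg (r : ℝ) (k : ℕ) : 0 ≤ steinZero r k :=
  intervalIntegral.integral_nonneg zero_le_one fun s hs => by
    have := hs.1; positivity

lemma steinZero_le_one {r : ℝ} (hr : 0 ≤ r) (k : ℕ) : steinZero r k ≤ 1 := by
  have : steinZero r k ≤ ∫ _ in (0 : ℝ)..1, (1 : ℝ) := by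
    refine intervalIntegral.integral_mono_on zero_le_one ?_ (by simp) fun s hs => ?_
    · exact Continuous.intervalIntegrable (by fun_prop) _ _
    · have h1 : Real.exp (-(r * s)) ≤ 1 := by
        rw [Real.exp_le_one_iff]; have := mul_nonneg hr hs.1; linarith
      have h2 : s ^ k ≤ 1 := pow_le_one₀ hs.1 hs.2
      exact mul_le_one₀ h1 (pow_nonneg hs.1 k) h2
  simpa using this

/-- This crude bound, without the usual factor 1/r, suffices because r stays bounded at the
thresholds used. -/
lemma abs_steinZero_sub_le {r : ℝ} (hr : 0 ≤ r) (j k : ℕ) :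
    |steinZero r j - steinZero r k| ≤ 1 := by
  rw [abs_le]
  constructor <;>
  linarith [steinZero_nonneg r j, steinZero_nonneg r k, steinZero_le_one hr j,
    steinZero_le_one hr k]

/-- The right side integrates the derivative of -exp(-rs) s^k over [0, 1], and the boundary values
give the left side. At k = 0 the truncated `k - 1` is harmless, being multiplied by 0. -/
lemma steinZero_equation (r : ℝ) (k : ℕ) :
    (if k = 0 then 1 else 0) - Real.exp (-r) = r * steinZero r k - k * steinZero r (k - 1) := by
  have hd : ∀ s : ℝ, HasDerivAt (fun s => -(Real.exp (-(r * s)) * s ^ k))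
      (r * (Real.exp (-(r * s)) * s ^ k) - k * (Real.exp (-(r * s)) * s ^ (k - 1))) s := by
    intro s
    have h1 : HasDerivAt (fun s : ℝ => Real.exp (-(r * s))) (Real.exp (-(r * s)) * (-(r * 1))) s :=
      (((hasDerivAt_id s).const_mul r).neg).exp
    exact (h1.mul (hasDerivAt_pow k s)).neg.congr_deriv (by ring)
  have h := intervalIntegral.integral_eq_sub_of_hasDerivAt (a := 0) (b := 1) (fun s _ => hd s)
    (Continuous.intervalIntegrable (by fun_prop) _ _)
  rw [intervalIntegral.integral_sub (Continuous.intervalIntegrable (by fun_prop) _ _)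
    (Continuous.intervalIntegrable (by fun_prop) _ _), intervalIntegral.integral_const_mul,
    intervalIntegral.integral_const_mul] at h
  unfold steinZero
  rw [h]
  rcases eq_or_ne k 0 with rfl | hk
  · simp only [↓reduceIte, pow_zero, mul_zero, neg_zero, Real.exp_zero, mul_one]
    ring
  · simp [hk]

/-- The Chen–Stein bound for the probability that no event of a finite family occurs, where each
`A i` is independent of the number of events that occur outside of its neighbourhood `B i`. -/
theorem abs_measureReal_none_sub_exp_le {Ω ι : Type*} [MeasurableSpace Ω] (μ : Measure Ω)
    [IsProbabilityMeasure μ] [Fintype ι] [DecidableEq ι] (A : ι → Set Ω)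
    (hA : ∀ i, MeasurableSet (A i)) (B : ι → Finset ι) (hB : ∀ i, i ∈ B i)
    (hind : ∀ i, IndepFun ((A i).indicator (1 : Ω → ℕ))
      (fun ω => ∑ j ∈ (B i)ᶜ, (A j).indicator (1 : Ω → ℕ) ω) μ) :
    |μ.real (⋂ i, (A i)ᶜ) - Real.exp (-∑ i, μ.real (A i))| ≤
      ∑ i, ∑ j ∈ B i, μ.real (A i) * μ.real (A j) +
      ∑ i, ∑ j ∈ (B i).erase i, μ.real (A i ∩ A j) := by
  set r := ∑ i, μ.real (A i) with hr
  have hr0 : 0 ≤ r := Finset.sum_nonneg fun i _ => measureReal_nonneg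
  set N : Finset ι → Ω → ℕ := fun S ω => ∑ j ∈ S, (A j).indicator (1 : Ω → ℕ) ω with hN
  set g := steinZero r with hg
  have hXm : ∀ i, Measurable ((A i).indicator (1 : Ω → ℕ)) := fun i =>
    measurable_one.indicator (hA i)
  have hNm : ∀ S, Measurable (N S) := fun S =>
    Finset.measurable_sum S fun j _ => hXm j
  have hgN : ∀ S, Integrable (fun ω => g (N S ω)) μ := fun S => by
    refine Integrable.of_bound (C := 1)
      ((measurable_of_countable g).comp (hNm S)).aestronglyMeasurable (ae_of_all _ fun ω => ?_)
    rw [Real.norm_eq_abs, abs_of_nonneg (steinZero_nonneg _ _)]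
    exact steinZero_le_one hr0 _
  have hone : ∀ s : Set Ω, MeasurableSet s → Integrable (s.indicator (1 : Ω → ℝ)) μ := fun s hs =>
    (integrable_const (1 : ℝ)).indicator hs
  have hAi : ∀ i, Integrable ((A i).indicator (1 : Ω → ℝ)) μ := fun i => hone _ (hA i)
  have hXg : ∀ i S, Integrable (fun ω => (A i).indicator (1 : Ω → ℝ) ω * g (N S ω)) μ :=
    fun i S => by
      have := (hgN S).indicator (hA i)
      refine this.congr (ae_of_all _ fun ω => ?_)
      by_cases h : ω ∈ A i <;> simp [h]
  have hAint : ∀ i, ∫ ω, (A i).indicator (1 : Ω → ℝ) ω ∂μ = μ.real (A i) := fun i => by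
    rw [integral_indicator_one (hA i)]
  -- changing the set of events that are counted
  have hchange : ∀ S T : Finset ι, T ⊆ S → ∀ ω,
      |g (N S ω) - g (N T ω)| ≤ ∑ j ∈ S \ T, (A j).indicator (1 : Ω → ℝ) ω := by
    intro S T hTS ω
    have hsplit : N S ω = N (S \ T) ω + N T ω := (Finset.sum_sdiff hTS).symm
    have hcast : ∑ j ∈ S \ T, (A j).indicator (1 : Ω → ℝ) ω = (N (S \ T) ω : ℝ) := by
      simp only [hN, Nat.cast_sum]
      refine Finset.sum_congr rfl fun j _ => ?_
      by_cases h : ω ∈ A j <;> simp [h]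
    rw [hcast, hsplit]
    -- If the two counts differ, they differ by at least 1, which dominates the oscillation of `g`.
    rcases Nat.eq_zero_or_pos (N (S \ T) ω) with h | h
    · simp [h]
    · exact (abs_steinZero_sub_le hr0 _ _).trans (by exact_mod_cast h)
  -- the Stein equation in expectation
  have hW : μ.real (⋂ i, (A i)ᶜ) - Real.exp (-r) =
      ∑ i, (μ.real (A i) * ∫ ω, g (N Finset.univ ω) ∂μ -
        ∫ ω, (A i).indicator (1 : Ω → ℝ) ω * g (N (Finset.univ.erase i) ω) ∂μ) := by
    have hpt : ∀ ω, (⋂ i, (A i)ᶜ).indicator (1 : Ω → ℝ) ω - Real.exp (-r) =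
        r * g (N Finset.univ ω) -
          ∑ i, (A i).indicator (1 : Ω → ℝ) ω * g (N (Finset.univ.erase i) ω) := by
      intro ω
      have h0 : (⋂ i, (A i)ᶜ).indicator (1 : Ω → ℝ) ω =
          if N Finset.univ ω = 0 then 1 else 0 := by
        have : N Finset.univ ω = 0 ↔ ω ∈ ⋂ i, (A i)ᶜ := by
          simp [hN, Finset.sum_eq_zero_iff]
        by_cases h : ω ∈ ⋂ i, (A i)ᶜ
        · rw [if_pos (this.2 h), Set.indicator_of_mem h]; rfl
        · rw [if_neg (fun h' => h (this.1 h')), Set.indicator_of_notMem h]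
      -- On `A i` the total count is one more than the count without i, so the shift in the Stein
      -- equation becomes the omission of i.
      have h1 : ∀ i, (A i).indicator (1 : Ω → ℝ) ω * g (N (Finset.univ.erase i) ω) =
          (A i).indicator (1 : Ω → ℝ) ω * g (N Finset.univ ω - 1) := by
        intro i
        by_cases h : ω ∈ A i
        · have : N Finset.univ ω = N (Finset.univ.erase i) ω + 1 := by
            have := (Finset.sum_erase_add Finset.univ
              (fun j => (A j).indicator (1 : Ω → ℕ) ω) (Finset.mem_univ i)).symm
            simpa [hN, h] using this
          rw [this, Nat.add_sub_cancel]
        · simp [h]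
      have h2 : ∑ i, (A i).indicator (1 : Ω → ℝ) ω = (N Finset.univ ω : ℝ) := by
        simp only [hN, Nat.cast_sum]
        refine Finset.sum_congr rfl fun j _ => ?_
        by_cases h : ω ∈ A j <;> simp [h]
      rw [h0, steinZero_equation, Finset.sum_congr rfl fun i _ => h1 i, ← Finset.sum_mul, h2]
    have hmeas : MeasurableSet (⋂ i, (A i)ᶜ) := MeasurableSet.iInter fun i => (hA i).compl
    have hint := integral_congr_ae (μ := μ) (ae_of_all _ hpt)
    rw [integral_sub (hone _ hmeas) (integrable_const _),
      integral_sub ((hgN _).const_mul r) (integrable_finsetSum _ fun i _ => hXg i _),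
      integral_indicator_one hmeas, integral_const_mul,
      integral_finsetSum _ fun i _ => hXg i _] at hint
    rw [Finset.sum_sub_distrib, ← Finset.sum_mul, ← hr]
    simpa using hint
  rw [hW, ← Finset.sum_add_distrib]
  refine (Finset.abs_sum_le_sum_abs _ _).trans (Finset.sum_le_sum fun i _ => ?_)
  -- Both terms are compared with the count outside `B i`, where independence makes them equal;
  -- `hb1` and `hb2` are the costs of the two replacements.
  have hprod : ∫ ω, (A i).indicator (1 : Ω → ℝ) ω * g (N (B i)ᶜ ω) ∂μ =
      μ.real (A i) * ∫ ω, g (N (B i)ᶜ ω) ∂μ := by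
    have h := (hind i).comp (φ := fun k : ℕ => (k : ℝ)) (ψ := g) (measurable_of_countable _)
      (measurable_of_countable _)
    have h' := h.integral_fun_mul_eq_mul_integral
      ((measurable_of_countable (fun k : ℕ => (k : ℝ))).comp (hXm i)).aestronglyMeasurable
      ((measurable_of_countable g).comp (hNm (B i)ᶜ)).aestronglyMeasurable
    have hc : ∀ ω, (((A i).indicator (1 : Ω → ℕ) ω : ℕ) : ℝ) = (A i).indicator (1 : Ω → ℝ) ω := by
      intro ω; by_cases h : ω ∈ A i <;> simp [h]
    simp only [Function.comp_def, hc] at h'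
    rw [hAint] at h'
    exact h'
  have hb1 : |∫ ω, g (N Finset.univ ω) ∂μ - ∫ ω, g (N (B i)ᶜ ω) ∂μ| ≤ ∑ j ∈ B i, μ.real (A j) := by
    rw [← integral_sub (hgN _) (hgN _)]
    refine (abs_integral_le_integral_abs).trans ?_
    have : ∑ j ∈ B i, μ.real (A j) = ∫ ω, ∑ j ∈ B i, (A j).indicator (1 : Ω → ℝ) ω ∂μ := by
      rw [integral_finsetSum _ fun j _ => hAi j]
      simp_rw [hAint]
    rw [this]
    refine integral_mono ((hgN _).sub (hgN _)).abs
      (integrable_finsetSum _ fun j _ => hAi j) fun ω => ?_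
    have := hchange Finset.univ (B i)ᶜ (Finset.subset_univ _) ω
    simpa [← Finset.compl_eq_univ_sdiff] using this
  have hb2 : |∫ ω, (A i).indicator (1 : Ω → ℝ) ω * g (N (B i)ᶜ ω) ∂μ -
      ∫ ω, (A i).indicator (1 : Ω → ℝ) ω * g (N (Finset.univ.erase i) ω) ∂μ| ≤
      ∑ j ∈ (B i).erase i, μ.real (A i ∩ A j) := by
    rw [← integral_sub (hXg _ _) (hXg _ _)]
    refine (abs_integral_le_integral_abs).trans ?_
    have : ∑ j ∈ (B i).erase i, μ.real (A i ∩ A j) =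
        ∫ ω, ∑ j ∈ (B i).erase i, (A i ∩ A j).indicator (1 : Ω → ℝ) ω ∂μ := by
      rw [integral_finsetSum _ fun j _ =>
        hone _ ((hA i).inter (hA j))]
      exact Finset.sum_congr rfl fun j _ =>
        (integral_indicator_one ((hA i).inter (hA j))).symm
    rw [this]
    refine integral_mono ((hXg _ _).sub (hXg _ _)).abs (integrable_finsetSum _ fun j _ =>
        hone _ ((hA i).inter (hA j))) fun ω => ?_
    have hsub : (B i)ᶜ ⊆ Finset.univ.erase i := fun j hj =>
      Finset.mem_erase.2 ⟨fun h => Finset.mem_compl.1 hj (h ▸ hB i), Finset.mem_univ j⟩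
    have hsd : Finset.univ.erase i \ (B i)ᶜ = (B i).erase i := by
      ext j; simp
    have := hchange (Finset.univ.erase i) (B i)ᶜ hsub ω
    rw [hsd, abs_sub_comm] at this
    by_cases h : ω ∈ A i
    · have hj : ∀ j, (A i ∩ A j).indicator (1 : Ω → ℝ) ω = (A j).indicator (1 : Ω → ℝ) ω := by
        intro j; by_cases h' : ω ∈ A j <;> simp [h, h']
      simpa [h, hj] using this
    · simp [h]
  rw [hprod] at hb2
  rw [← Finset.mul_sum]
  calc _ = |μ.real (A i) * (∫ ω, g (N Finset.univ ω) ∂μ - ∫ ω, g (N (B i)ᶜ ω) ∂μ) +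
        (μ.real (A i) * ∫ ω, g (N (B i)ᶜ ω) ∂μ -
          ∫ ω, (A i).indicator (1 : Ω → ℝ) ω * g (N (Finset.univ.erase i) ω) ∂μ)| := by
        congr 1; ring
    _ ≤ _ := by
        refine (abs_add_le _ _).trans (add_le_add ?_ hb2)
        rw [abs_mul, abs_of_nonneg measureReal_nonneg]
        exact mul_le_mul_of_nonneg_left hb1 measureReal_nonneg

/-! ### Tail integrals of powers of 1 + b² -/

/-- The tail integral `∫_τ^∞ (1 + b²) ^ (-a) db`. -/
noncomputable def cauchyTail (a τ : ℝ) : ℝ := ∫ b in Set.Ioi τ, (1 + b ^ 2) ^ (-a)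

lemma integrable_one_add_sq_rpow {a : ℝ} (ha : 1 / 2 < a) :
    Integrable fun b : ℝ => (1 + b ^ 2) ^ (-a) := by
  have h := integrable_rpow_neg_one_add_norm_sq (E := ℝ) (μ := volume) (r := 2 * a)
    (by rw [Module.finrank_self]; push_cast; linarith)
  refine h.congr (ae_of_all _ fun b => ?_)
  simp only [Real.norm_eq_abs, sq_abs]
  rw [show -(2 * a) / 2 = -a by ring]

lemma tendsto_one_add_sq_rpow {c : ℝ} (hc : 0 < c) :
    Tendsto (fun b : ℝ => (1 + b ^ 2) ^ (-c)) atTop (𝓝 0) :=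
  (tendsto_rpow_neg_atTop hc).comp
    (tendsto_atTop_add_const_left _ 1 (tendsto_pow_atTop two_ne_zero))

lemma hasDerivAt_one_add_sq_rpow (a b : ℝ) :
    HasDerivAt (fun b : ℝ => (1 + b ^ 2) ^ (1 - a)) (2 * b * (1 - a) * (1 + b ^ 2) ^ (-a)) b := by
  have h1 : HasDerivAt (fun b : ℝ => 1 + b ^ 2) (2 * b) b := by
    simpa using (hasDerivAt_pow 2 b).const_add 1
  have h := h1.rpow_const (p := 1 - a) (Or.inl (by positivity))
  convert h using 2
  ring_nf

/-- For b > τ the factor b / τ is at least 1, and it gives the integrand an explicit antiderivative.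
-/
lemma cauchyTail_le {a τ : ℝ} (ha : 1 < a) (hτ : 0 < τ) :
    cauchyTail a τ ≤ (1 + τ ^ 2) ^ (1 - a) / (2 * (a - 1) * τ) := by
  have ha' : 0 < a - 1 := by linarith
  have hd : ∀ b ∈ Set.Ici τ, HasDerivAt (fun b : ℝ => -((1 + b ^ 2) ^ (1 - a) / (2 * (a - 1) * τ)))
      (b / τ * (1 + b ^ 2) ^ (-a)) b := fun b _ => by
    refine ((hasDerivAt_one_add_sq_rpow a b).div_const _).neg.congr_deriv ?_
    field_simp
    ring
  have hpos : ∀ b ∈ Set.Ioi τ, 0 ≤ b / τ * (1 + b ^ 2) ^ (-a) := fun b hb => by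
    have : 0 < b := hτ.trans hb
    positivity
  have ht : Tendsto (fun b : ℝ => -((1 + b ^ 2) ^ (1 - a) / (2 * (a - 1) * τ))) atTop (𝓝 0) := by
    have := ((tendsto_one_add_sq_rpow ha').div_const (2 * (a - 1) * τ)).neg
    simpa using this
  have hi := integral_Ioi_of_hasDerivAt_of_nonneg' hd hpos ht
  rw [zero_sub, neg_neg] at hi
  rw [← hi]
  refine setIntegral_mono_on (integrable_one_add_sq_rpow (by linarith)).integrableOn
    (integrableOn_Ioi_deriv_of_nonneg' hd hpos ht) measurableSet_Ioi fun b hb => ?_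
  have h1 : 1 ≤ b / τ := (one_le_div hτ).2 (le_of_lt hb)
  have h2 : 0 ≤ (1 + b ^ 2) ^ (-a) := by positivity
  nlinarith

/-- Differentiating -(1 + b²)^(1 - a) / (2(a - 1)b) yields the integrand times a factor that
decreases in b, hence is largest at τ. -/
lemma le_cauchyTail {a τ : ℝ} (ha : 1 < a) (hτ : 0 < τ) :
    (1 + τ ^ 2) ^ (1 - a) / (2 * (a - 1) * τ) ≤
      (1 + (1 + (τ ^ 2)⁻¹) / (2 * (a - 1))) * cauchyTail a τ := by
  have ha' : 0 < a - 1 := by linarith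
  have hrp : ∀ b : ℝ, (1 + b ^ 2) ^ (1 - a) = (1 + b ^ 2) * (1 + b ^ 2) ^ (-a) := fun b => by
    rw [sub_eq_add_neg, Real.rpow_add (by positivity), Real.rpow_one]
  have hd : ∀ b ∈ Set.Ici τ, HasDerivAt (fun b : ℝ => -((1 + b ^ 2) ^ (1 - a) / (2 * (a - 1) * b)))
      ((1 + (1 + (b ^ 2)⁻¹) / (2 * (a - 1))) * (1 + b ^ 2) ^ (-a)) b := fun b hb => by
    have hb0 : 0 < b := hτ.trans_le hb
    have h2 : HasDerivAt (fun b : ℝ => 2 * (a - 1) * b) (2 * (a - 1) * 1) b :=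
      (hasDerivAt_id b).const_mul _
    refine ((hasDerivAt_one_add_sq_rpow a b).div h2 (by positivity)).neg.congr_deriv ?_
    rw [hrp]
    field_simp
    ring
  have hpos : ∀ b ∈ Set.Ioi τ,
      0 ≤ (1 + (1 + (b ^ 2)⁻¹) / (2 * (a - 1))) * (1 + b ^ 2) ^ (-a) := fun b hb => by
    positivity
  have ht : Tendsto (fun b : ℝ => -((1 + b ^ 2) ^ (1 - a) / (2 * (a - 1) * b))) atTop (𝓝 0) := by
    have h1 : Tendsto (fun b : ℝ => (2 * (a - 1) * b)⁻¹) atTop (𝓝 0) :=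
      (tendsto_id.const_mul_atTop (by positivity)).inv_tendsto_atTop
    have h0 := (tendsto_one_add_sq_rpow ha').mul h1
    simpa [div_eq_mul_inv] using h0.neg
  have hi := integral_Ioi_of_hasDerivAt_of_nonneg' hd hpos ht
  rw [zero_sub, neg_neg] at hi
  rw [← hi, cauchyTail, ← integral_const_mul]
  refine setIntegral_mono_on (integrableOn_Ioi_deriv_of_nonneg' hd hpos ht)
    ((integrable_one_add_sq_rpow (by linarith)).integrableOn.const_mul _) measurableSet_Ioi
    fun b hb => ?_
  have hb' : τ < b := hb
  gcongr

lemma cauchyTail_zero_pos {a : ℝ} (ha : 1 / 2 < a) : 0 < cauchyTail a 0 := by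
  rw [cauchyTail, setIntegral_pos_iff_support_of_nonneg_ae
    (ae_of_all _ fun b => by positivity) (integrable_one_add_sq_rpow ha).integrableOn]
  have : Function.support (fun b : ℝ => (1 + b ^ 2) ^ (-a)) = Set.univ := by
    ext b
    simp only [Function.mem_support, Set.mem_univ, iff_true]
    positivity
  rw [this, Set.univ_inter]
  simp

/-- The substitution b = s / √(2a) turns the integrand into (1 + s²/(2a))^(-a), which tends to
exp(-s²/2); Bernoulli's inequality dominates it for a ≥ 1. -/
lemma tendsto_sqrt_mul_cauchyTail_zero :
    Tendsto (fun a : ℝ => √(2 * a) * cauchyTail a 0) atTop (𝓝 (√(Real.pi / 2))) := by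
  have hlim : ∫ s in Set.Ioi (0 : ℝ), Real.exp (-(1 / 2) * s ^ 2) = √(Real.pi / 2) := by
    rw [integral_gaussian_Ioi, show Real.pi / (1 / 2) = 2 ^ 2 * (Real.pi / 2) by ring,
      Real.sqrt_mul (by positivity), Real.sqrt_sq (by norm_num)]
    ring
  have hd : Tendsto (fun a : ℝ => ∫ s in Set.Ioi (0 : ℝ), (1 + s ^ 2 / 2 / a) ^ (-a)) atTop
      (𝓝 (∫ s in Set.Ioi (0 : ℝ), Real.exp (-(1 / 2) * s ^ 2))) := by
    refine tendsto_integral_filter_of_dominated_convergence (fun s => 2 * (1 + s ^ 2)⁻¹) ?_ ?_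
      (integrable_inv_one_add_sq.const_mul 2).integrableOn ?_
    · refine Eventually.of_forall fun a => Measurable.aestronglyMeasurable ?_
      fun_prop
    · filter_upwards [eventually_ge_atTop 1] with a ha
      refine ae_of_all _ fun s => ?_
      have ha0 : 0 < a := by linarith
      have hb : 1 + a * (s ^ 2 / 2 / a) ≤ (1 + s ^ 2 / 2 / a) ^ a :=
        one_add_mul_self_le_rpow_one_add ((by norm_num : (-1 : ℝ) ≤ 0).trans (by positivity)) ha
      rw [mul_div_cancel₀ _ ha0.ne'] at hb
      rw [Real.norm_eq_abs, abs_of_nonneg (by positivity), Real.rpow_neg (by positivity),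
        ← div_eq_mul_inv, inv_eq_one_div, div_le_div_iff₀ (by positivity) (by positivity)]
      nlinarith [sq_nonneg s]
    · refine ae_of_all _ fun s => ?_
      have h := (Real.tendsto_one_add_div_rpow_exp (s ^ 2 / 2)).inv₀ (Real.exp_ne_zero _)
      rw [← Real.exp_neg] at h
      have he : -(1 / 2) * s ^ 2 = -(s ^ 2 / 2) := by ring
      rw [he]
      refine h.congr' ?_
      filter_upwards [eventually_gt_atTop 0] with a ha
      rw [Real.rpow_neg (by positivity)]
  rw [← hlim]
  refine hd.congr' ?_
  filter_upwards [eventually_gt_atTop 0] with a ha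
  have hr : 0 < √(2 * a) := Real.sqrt_pos.2 (by positivity)
  have h := integral_comp_mul_left_Ioi (fun b : ℝ => (1 + b ^ 2) ^ (-a)) 0 (inv_pos.2 hr)
  rw [inv_inv, mul_zero, smul_eq_mul] at h
  rw [cauchyTail, ← h]
  refine setIntegral_congr_fun measurableSet_Ioi fun s _ => ?_
  simp only [mul_pow, inv_pow, Real.sq_sqrt (show 0 ≤ 2 * a by positivity)]
  congr 2
  field_simp

/-! ### Volume of a cone inside the unit ball -/

section cone

open scoped ENNReal

variable {W : Type*} [NormedAddCommGroup W] [MeasurableSpace W] [BorelSpace W]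

/-- The norm function restricted to the closed unit ball. -/
noncomputable def ballNorm (w : W) : ℝ≥0∞ :=
  (Metric.closedBall (0 : W) 1).indicator (fun w => ‖w‖ₑ) w

lemma measurable_ballNorm : Measurable (ballNorm : W → ℝ≥0∞) :=
  measurable_enorm.indicator measurableSet_closedBall

variable [InnerProductSpace ℝ W]

/-- Substitute a = ‖w‖ b: the cone condition no longer involves w, and the ball condition becomes
‖√(1 + b²) w‖ ≤ 1. The inverse root turns the norm inside `ballNorm` back into the Jacobian ‖w‖. -/
lemma volume_cone_slice (τ : ℝ) {w : W} (hw : w ≠ 0) :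
    volume {a : ℝ | τ * ‖w‖ ≤ |a| ∧ a ^ 2 + ‖w‖ ^ 2 ≤ 1} =
      ∫⁻ b in {b : ℝ | τ ≤ |b|}, ENNReal.ofReal ((√(1 + b ^ 2))⁻¹) *
        ballNorm (√(1 + b ^ 2) • w) := by
  have hw0 : 0 < ‖w‖ := norm_pos_iff.2 hw
  have hpre : (fun b : ℝ => ‖w‖ • b) ⁻¹' {a : ℝ | τ * ‖w‖ ≤ |a| ∧ a ^ 2 + ‖w‖ ^ 2 ≤ 1} =
      {b : ℝ | √(1 + b ^ 2) • w ∈ Metric.closedBall (0 : W) 1} ∩ {b : ℝ | τ ≤ |b|} := by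
    ext b
    simp only [smul_eq_mul, Set.mem_preimage, Set.mem_ofPred_eq, Set.mem_inter_iff,
      mem_closedBall_zero_iff, norm_smul, Real.norm_eq_abs, abs_mul, abs_norm,
      abs_of_nonneg (Real.sqrt_nonneg _)]
    rw [mul_comm τ, mul_le_mul_iff_right₀ hw0, and_comm]
    refine and_congr_left fun _ => ?_
    rw [← sq_le_one_iff₀ (by positivity : 0 ≤ √(1 + b ^ 2) * ‖w‖), mul_pow,
      mul_pow, Real.sq_sqrt (by positivity)]
    constructor <;> intro h <;> linarith
  have hvol := Measure.addHaar_preimage_smul (volume : Measure ℝ) hw0.ne'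
    {a : ℝ | τ * ‖w‖ ≤ |a| ∧ a ^ 2 + ‖w‖ ^ 2 ≤ 1}
  have hm : MeasurableSet {b : ℝ | √(1 + b ^ 2) • w ∈ Metric.closedBall (0 : W) 1} :=
    measurableSet_preimage (by fun_prop) measurableSet_closedBall
  have hmul : ‖w‖ₑ * volume ((fun b : ℝ => ‖w‖ • b) ⁻¹'
      {a : ℝ | τ * ‖w‖ ≤ |a| ∧ a ^ 2 + ‖w‖ ^ 2 ≤ 1}) =
      volume {a : ℝ | τ * ‖w‖ ≤ |a| ∧ a ^ 2 + ‖w‖ ^ 2 ≤ 1} := by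
    rw [hvol, Module.finrank_self, pow_one, abs_of_pos (inv_pos.2 hw0), ← mul_assoc,
      ← ofReal_norm, ← ENNReal.ofReal_mul hw0.le, mul_inv_cancel₀ hw0.ne',
      ENNReal.ofReal_one, one_mul]
  rw [← hmul, hpre, ← Measure.restrict_apply hm, ← lintegral_indicator_one hm,
    ← lintegral_const_mul _ (measurable_one.indicator hm)]
  refine lintegral_congr fun b => ?_
  have hr : 0 < √(1 + b ^ 2) := Real.sqrt_pos.2 (by positivity)
  by_cases hb : √(1 + b ^ 2) • w ∈ Metric.closedBall (0 : W) 1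
  · have hb' : b ∈ {b : ℝ | √(1 + b ^ 2) • w ∈ Metric.closedBall (0 : W) 1} := hb
    rw [ballNorm, Set.indicator_of_mem hb, Set.indicator_of_mem hb', Pi.one_apply, mul_one,
      ← ofReal_norm, ← ofReal_norm, ← ENNReal.ofReal_mul (by positivity),
      norm_smul, Real.norm_eq_abs, abs_of_pos hr, inv_mul_cancel_left₀ hr.ne']
  · have hb' : b ∉ {b : ℝ | √(1 + b ^ 2) • w ∈ Metric.closedBall (0 : W) 1} := hb
    rw [ballNorm, Set.indicator_of_notMem hb, Set.indicator_of_notMem hb', mul_zero, mul_zero]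

variable [FiniteDimensional ℝ W]

/-- Rescaling w contributes the power dim W of 1/√(1 + b²), and the prefactor one more. -/
lemma lintegral_ballNorm_smul (b : ℝ) :
    ∫⁻ w : W, ENNReal.ofReal ((√(1 + b ^ 2))⁻¹) * ballNorm (√(1 + b ^ 2) • w) =
      ENNReal.ofReal ((1 + b ^ 2) ^ (-((Module.finrank ℝ W + 1 : ℝ) / 2))) *
        ∫⁻ w : W, ballNorm w := by
  have hr : 0 < √(1 + b ^ 2) := Real.sqrt_pos.2 (by positivity)
  have hm : Measurable fun w : W => ballNorm (√(1 + b ^ 2) • w) :=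
    measurable_ballNorm.comp (measurable_const_smul _)
  rw [lintegral_const_mul _ hm,
    ← lintegral_map measurable_ballNorm (measurable_const_smul _),
    Measure.map_addHaar_smul volume hr.ne', lintegral_smul_measure, smul_eq_mul, ← mul_assoc,
    ← ENNReal.ofReal_mul (by positivity)]
  congr 2
  rw [abs_of_nonneg (by positivity), ← mul_inv, ← pow_succ', Real.rpow_neg (by positivity),
    Real.sqrt_eq_rpow, ← Real.rpow_natCast, ← Real.rpow_mul (by positivity)]
  congr 2
  push_cast; ring

lemma lintegral_one_add_sq_rpow {a τ : ℝ} (ha : 1 / 2 < a) (hτ : 0 ≤ τ) :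
    ∫⁻ b in {b : ℝ | τ ≤ |b|}, ENNReal.ofReal ((1 + b ^ 2) ^ (-a)) =
      ENNReal.ofReal (2 * cauchyTail a τ) := by
  have hm : MeasurableSet {b : ℝ | τ ≤ |b|} := measurableSet_le measurable_const (by fun_prop)
  rw [← ofReal_integral_eq_lintegral_ofReal (integrable_one_add_sq_rpow ha).integrableOn
    (ae_of_all _ fun b => by positivity)]
  congr 1
  have h := integral_comp_abs (f := (Set.Ici τ).indicator fun b : ℝ => (1 + b ^ 2) ^ (-a))
  rw [setIntegral_indicator measurableSet_Ici] at h
  rw [← integral_indicator hm]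
  have h2 : ∫ b in Set.Ioi 0 ∩ Set.Ici τ, ((1 : ℝ) + b ^ 2) ^ (-a) = cauchyTail a τ := by
    rw [cauchyTail]
    refine setIntegral_congr_set ?_
    have hsub : (Set.Ioi 0 ∩ Set.Ici τ : Set ℝ) =ᵐ[volume] (Set.Ici 0 ∩ Set.Ici τ : Set ℝ) :=
      Ioi_ae_eq_Ici.inter (ae_eq_refl _)
    rw [Set.inter_eq_right.2 (Set.Ici_subset_Ici.2 hτ)] at hsub
    exact hsub.trans Ioi_ae_eq_Ici.symm
  rw [h2] at h
  rw [← h]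
  refine integral_congr_ae (ae_of_all _ fun b => ?_)
  by_cases hb : τ ≤ |b| <;> simp [Set.indicator, hb]

/-- Once the order of integration is exchanged, τ affects only a one-dimensional tail; the other
factor cancels on comparison with τ = 0. -/
lemma volume_ball_inter_cone_eq_mul_lintegral [Nontrivial W] {τ : ℝ} (hτ : 0 ≤ τ) :
    volume (Metric.closedBall (0 : WithLp 2 (ℝ × W)) 1 ∩ {v | τ * ‖v.snd‖ ≤ |v.fst|}) =
      ENNReal.ofReal (2 * cauchyTail ((Module.finrank ℝ W + 1 : ℝ) / 2) τ) *
        ∫⁻ w : W, ballNorm w := by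
  set S : Set (ℝ × W) := {q | τ * ‖q.2‖ ≤ |q.1|} ∩ {q | q.1 ^ 2 + ‖q.2‖ ^ 2 ≤ 1} with hS
  have hSm : MeasurableSet S :=
    (measurableSet_le (by fun_prop) (by fun_prop)).inter
      (measurableSet_le (by fun_prop) (by fun_prop))
  have hpre : Metric.closedBall (0 : WithLp 2 (ℝ × W)) 1 ∩ {v | τ * ‖v.snd‖ ≤ |v.fst|} =
      WithLp.ofLp ⁻¹' S := by
    ext v
    simp only [Set.mem_inter_iff, mem_closedBall_zero_iff, Set.mem_ofPred_eq, Set.mem_preimage, hS]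
    rw [and_comm]
    refine and_congr_right fun _ => ?_
    rw [← sq_le_one_iff₀ (norm_nonneg v), WithLp.prod_norm_sq_eq_of_L2, Real.norm_eq_abs, sq_abs]
    rfl
  rw [hpre, (WithLp.volume_preserving_ofLp ℝ W).measure_preimage hSm.nullMeasurableSet,
    Measure.volume_eq_prod, Measure.prod_apply_symm hSm]
  have h0 : ∀ᵐ w : W, w ≠ 0 := by
    simp [ae_iff]
  have hmeas : Measurable (Function.uncurry fun (w : W) (b : ℝ) =>
      ENNReal.ofReal ((√(1 + b ^ 2))⁻¹) * ballNorm (√(1 + b ^ 2) • w)) := by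
    refine Measurable.mul (by fun_prop) (measurable_ballNorm.comp ?_)
    fun_prop
  calc ∫⁻ w : W, volume ((fun a : ℝ => (a, w)) ⁻¹' S)
      = ∫⁻ w : W, ∫⁻ b in {b : ℝ | τ ≤ |b|}, ENNReal.ofReal ((√(1 + b ^ 2))⁻¹) *
          ballNorm (√(1 + b ^ 2) • w) :=
        lintegral_congr_ae (h0.mono fun w hw => volume_cone_slice τ hw)
    _ = ∫⁻ b in {b : ℝ | τ ≤ |b|}, ∫⁻ w : W, ENNReal.ofReal ((√(1 + b ^ 2))⁻¹) *
          ballNorm (√(1 + b ^ 2) • w) := lintegral_lintegral_swap hmeas.aemeasurable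
    _ = _ := by
        simp_rw [lintegral_ballNorm_smul]
        rw [lintegral_mul_const _ (by fun_prop), lintegral_one_add_sq_rpow _ hτ]
        have : (1 : ℝ) ≤ Module.finrank ℝ W := by exact_mod_cast Module.finrank_pos
        linarith

/-- The proportion of the unit ball of `ℝ × W` that lies in a cone around the axis `ℝ × 0`. -/
lemma volume_ball_inter_cone [Nontrivial W] {τ : ℝ} (hτ : 0 ≤ τ) :
    volume (Metric.closedBall (0 : WithLp 2 (ℝ × W)) 1 ∩ {v | τ * ‖v.snd‖ ≤ |v.fst|}) =
      ENNReal.ofReal (cauchyTail ((Module.finrank ℝ W + 1 : ℝ) / 2) τ /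
        cauchyTail ((Module.finrank ℝ W + 1 : ℝ) / 2) 0) *
        volume (Metric.closedBall (0 : WithLp 2 (ℝ × W)) 1) := by
  have h0 := volume_ball_inter_cone_eq_mul_lintegral (W := W) le_rfl
  have hu : {v : WithLp 2 (ℝ × W) | 0 * ‖v.snd‖ ≤ |v.fst|} = Set.univ := by
    ext v; simp
  have hk : (1 : ℝ) ≤ Module.finrank ℝ W := by exact_mod_cast Module.finrank_pos
  have hc := cauchyTail_zero_pos (a := (Module.finrank ℝ W + 1 : ℝ) / 2) (by linarith)
  have hτ0 : 0 ≤ cauchyTail ((Module.finrank ℝ W + 1 : ℝ) / 2) τ :=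
    setIntegral_nonneg measurableSet_Ioi fun b _ => by positivity
  rw [hu, Set.inter_univ] at h0
  rw [volume_ball_inter_cone_eq_mul_lintegral hτ, h0, ← mul_assoc,
    ← ENNReal.ofReal_mul (by positivity)]
  congr 2
  field_simp

end cone

/-! ### Spherical caps and rotation invariant laws -/

/-- `P (t ≤ |⟪x, u⟫|)` for a fixed unit vector `x` and a uniformly distributed unit vector `u` of
a Euclidean space of dimension `d`. -/
noncomputable def capProb (d : ℕ) (t : ℝ) : ℝ :=
  cauchyTail ((d : ℝ) / 2) (t / √(1 - t ^ 2)) / cauchyTail ((d : ℝ) / 2) 0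

lemma cauchyTail_nonneg (a τ : ℝ) : 0 ≤ cauchyTail a τ :=
  setIntegral_nonneg measurableSet_Ioi fun b _ => by positivity

lemma capProb_nonneg (d : ℕ) (t : ℝ) : 0 ≤ capProb d t :=
  div_nonneg (cauchyTail_nonneg _ _) (cauchyTail_nonneg _ _)

/-- As t → 1 the slope t / √(1 - t²) tends to infinity. The tail bound `cauchyTail_le` needs d / 2 >
1, hence d ≥ 3. -/
lemma tendsto_capProb_one {d : ℕ} (hd : 3 ≤ d) :
    Tendsto (capProb d) (𝓝[<] 1) (𝓝 0) := by
  have hd' : (3 : ℝ) ≤ d := by exact_mod_cast hd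
  have h1 : Tendsto (fun τ : ℝ => cauchyTail ((d : ℝ) / 2) τ) atTop (𝓝 0) := by
    have hg : Tendsto (fun τ : ℝ => 1 / (2 * ((d : ℝ) / 2 - 1)) * τ⁻¹) atTop (𝓝 0) := by
      simpa using tendsto_inv_atTop_zero.const_mul (1 / (2 * ((d : ℝ) / 2 - 1)))
    refine squeeze_zero' (Eventually.of_forall fun τ => cauchyTail_nonneg _ _) ?_ hg
    filter_upwards [eventually_gt_atTop 0] with τ hτ
    refine (cauchyTail_le (by linarith) hτ).trans ?_
    have h2 : (1 + τ ^ 2) ^ (1 - (d : ℝ) / 2) ≤ 1 :=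
      Real.rpow_le_one_of_one_le_of_nonpos (by nlinarith) (by linarith)
    rw [← div_eq_mul_inv, div_div]
    have : 0 < (d : ℝ) / 2 - 1 := by linarith
    gcongr
  have h2 : Tendsto (fun t : ℝ => t / √(1 - t ^ 2)) (𝓝[<] 1) atTop := by
    have h3 : Tendsto (fun t : ℝ => √(1 - t ^ 2)) (𝓝[<] 1) (𝓝[>] 0) := by
      refine tendsto_nhdsWithin_iff.2 ⟨?_, ?_⟩
      · have : Tendsto (fun t : ℝ => √(1 - t ^ 2)) (𝓝 1) (𝓝 (√(1 - 1 ^ 2))) :=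
          Continuous.tendsto (by fun_prop) 1
        simp only [one_pow, sub_self, Real.sqrt_zero] at this
        exact this.mono_left nhdsWithin_le_nhds
      · filter_upwards [Ioo_mem_nhdsLT (show (0 : ℝ) < 1 by norm_num)] with t ht
        exact Real.sqrt_pos.2 (by nlinarith [ht.1, ht.2])
    have h4 : Tendsto (fun t : ℝ => t) (𝓝[<] 1) (𝓝 1) := tendsto_id.mono_left nhdsWithin_le_nhds
    simpa only [div_eq_mul_inv, Function.comp_def] using
      h4.pos_mul_atTop one_pos (tendsto_inv_nhdsGT_zero.comp h3)
  have := (h1.comp h2).div_const (cauchyTail ((d : ℝ) / 2) 0)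
  rw [zero_div] at this
  exact this

section

open scoped ENNReal

variable {H : Type*} [NormedAddCommGroup H] [InnerProductSpace ℝ H] [FiniteDimensional ℝ H]

/-- Two inner product spaces of the same dimension are isometric, with a prescribed unit vector
sent to a prescribed unit vector. -/
lemma exists_linearIsometryEquiv_apply_eq {U : Type*} [NormedAddCommGroup U]
    [InnerProductSpace ℝ U] [FiniteDimensional ℝ U]
    (h : Module.finrank ℝ U = Module.finrank ℝ H) {u : U} {x : H} (hux : ‖u‖ = ‖x‖) :
    ∃ Φ : U ≃ₗᵢ[ℝ] H, Φ u = x := by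
  let Φ := (stdOrthonormalBasis ℝ U).equiv (stdOrthonormalBasis ℝ H) (finCongr h)
  refine ⟨Φ.trans (Submodule.reflection (ℝ ∙ (Φ u - x))ᗮ), ?_⟩
  rw [LinearIsometryEquiv.trans_apply]
  exact Submodule.reflection_sub (by simpa using hux)

/-- With t = cos θ, this passes from the cosine of the angle to its cotangent, the slope of the
cone. -/
lemma mul_sqrt_le_abs_iff {t a b : ℝ} (ht0 : 0 ≤ t) (ht1 : t < 1) (hb : 0 ≤ b) :
    t * √(a ^ 2 + b ^ 2) ≤ |a| ↔ t / √(1 - t ^ 2) * b ≤ |a| := by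
  have hs : 0 < 1 - t ^ 2 := by nlinarith
  have hr : 0 < √(1 - t ^ 2) := Real.sqrt_pos.2 hs
  rw [div_mul_eq_mul_div, div_le_iff₀ hr, ← sq_le_sq₀ (by positivity) (by positivity),
    ← sq_le_sq₀ (by positivity : 0 ≤ t * b) (by positivity), mul_pow, mul_pow, mul_pow,
    Real.sq_sqrt (by positivity), Real.sq_sqrt hs.le, sq_abs]
  constructor <;> intro h <;> linarith

variable [MeasurableSpace H] [BorelSpace H]

/-- An isometry taking the axis of ℝ × W to the direction of x reduces the cap to a cone. -/
lemma volume_ball_inter_cap (hd : 2 ≤ Module.finrank ℝ H) {t : ℝ} (ht0 : 0 ≤ t) (ht1 : t < 1)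
    {x : H} (hx : x ≠ 0) :
    volume (Metric.closedBall (0 : H) 1 ∩ {v | t * (‖x‖ * ‖v‖) ≤ |inner ℝ x v|}) =
      ENNReal.ofReal (capProb (Module.finrank ℝ H) t) * volume (Metric.closedBall (0 : H) 1) := by
  let W := EuclideanSpace ℝ (Fin (Module.finrank ℝ H - 1))
  have hW : Module.finrank ℝ W = Module.finrank ℝ H - 1 := finrank_euclideanSpace_fin
  have hW1 : (Module.finrank ℝ W + 1 : ℝ) = Module.finrank ℝ H := by
    rw [hW]; exact_mod_cast Nat.sub_add_cancel (by omega)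
  have : Nontrivial W := Module.nontrivial_of_finrank_pos (R := ℝ) (by omega)
  have hU : Module.finrank ℝ (WithLp 2 (ℝ × W)) = Module.finrank ℝ H := by
    rw [(WithLp.linearEquiv 2 ℝ (ℝ × W)).finrank_eq, Module.finrank_prod, Module.finrank_self, hW]
    omega
  have hx0 : 0 < ‖x‖ := norm_pos_iff.2 hx
  obtain ⟨Φ, hΦ⟩ := exists_linearIsometryEquiv_apply_eq hU
    (u := WithLp.toLp 2 ((1 : ℝ), (0 : W))) (x := ‖x‖⁻¹ • x) (by
      rw [norm_smul, norm_inv, norm_norm, inv_mul_cancel₀ hx0.ne',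
        ← sq_eq_sq₀ (norm_nonneg _) zero_le_one, WithLp.prod_norm_sq_eq_of_L2]
      simp)
  have hin : ∀ v : WithLp 2 (ℝ × W), inner ℝ x (Φ v) = ‖x‖ * v.fst := by
    intro v
    have hxx : x = ‖x‖ • Φ (WithLp.toLp 2 ((1 : ℝ), (0 : W))) := by
      rw [hΦ, smul_inv_smul₀ hx0.ne']
    rw [hxx, inner_smul_left, LinearIsometryEquiv.inner_map_map, ← hxx, WithLp.prod_inner_apply]
    simp
  have hpre : Φ ⁻¹' (Metric.closedBall (0 : H) 1 ∩ {v | t * (‖x‖ * ‖v‖) ≤ |inner ℝ x v|}) =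
      Metric.closedBall 0 1 ∩ {v | t / √(1 - t ^ 2) * ‖v.snd‖ ≤ |v.fst|} := by
    ext v
    simp only [Set.mem_preimage, Set.mem_inter_iff, mem_closedBall_zero_iff,
      LinearIsometryEquiv.norm_map, Set.mem_ofPred_eq, hin, abs_mul, abs_norm]
    refine and_congr_right fun _ => ?_
    rw [mul_left_comm, mul_le_mul_iff_right₀ hx0, ← mul_sqrt_le_abs_iff ht0 ht1 (norm_nonneg _),
      WithLp.prod_norm_eq_of_L2, Real.norm_eq_abs, sq_abs]
  have hballpre : Φ ⁻¹' Metric.closedBall (0 : H) 1 = Metric.closedBall 0 1 := by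
    ext v; simp
  have hm : MeasurableSet (Metric.closedBall (0 : H) 1 ∩
      {v | t * (‖x‖ * ‖v‖) ≤ |inner ℝ x v|}) :=
    measurableSet_closedBall.inter (measurableSet_le (by fun_prop) (by fun_prop))
  rw [← Φ.measurePreserving.measure_preimage hm.nullMeasurableSet, hpre,
    ← Φ.measurePreserving.measure_preimage measurableSet_closedBall.nullMeasurableSet, hballpre,
    volume_ball_inter_cone (by positivity), hW1, capProb]

variable {E : Type*} [NormedAddCommGroup E] [InnerProductSpace ℝ E] [FiniteDimensional ℝ E]
  [MeasurableSpace E] [BorelSpace E]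

/-- For a rotation invariant law `ν` on `E` and the projection `P` of `E` onto a subspace `H`, the
law of the angle between `P x` and a fixed vector of `H`. -/
lemma measure_cap_of_rotation_invariant (ν : Measure E) [IsProbabilityMeasure ν]
    (hν : ∀ R : E ≃ₗᵢ[ℝ] E, ν.map R = ν) (ι : H →ₗᵢ[ℝ] E) (P : E →L[ℝ] H)
    (hP : ∀ x v, inner ℝ (P x) v = inner ℝ x (ι v)) (hd : 2 ≤ Module.finrank ℝ H)
    {t : ℝ} (ht0 : 0 ≤ t) (ht1 : t < 1) {y : H} (hy : y ≠ 0) :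
    ν {x | P x ≠ 0 ∧ t * (‖P x‖ * ‖y‖) ≤ |inner ℝ (P x) y|} =
      ENNReal.ofReal (capProb (Module.finrank ℝ H) t) * ν {x | P x ≠ 0} := by
  have hPι : ∀ v, P (ι v) = v := fun v => ext_inner_right ℝ fun w => by rw [hP, ι.inner_map_map]
  set h : H → ℝ≥0∞ := fun v => ν {x | P x ≠ 0 ∧ t * (‖P x‖ * ‖v‖) ≤ |inner ℝ (P x) v|} with hh
  have hSm : MeasurableSet ({q : E × H | P q.1 ≠ 0} ∩
      {q : E × H | t * (‖P q.1‖ * ‖q.2‖) ≤ |inner ℝ (P q.1) q.2|}) := by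
    refine (measurableSet_eq_fun (by fun_prop) (by fun_prop)).compl.inter
      (measurableSet_le (by fun_prop) (by fun_prop))
  have hm : ∀ v, MeasurableSet {x | P x ≠ 0 ∧ t * (‖P x‖ * ‖v‖) ≤ |inner ℝ (P x) v|} := fun v =>
    (measurable_prodMk_right (y := v)) hSm
  -- invariance under reflections of `H`
  have hrefl : ∀ v : H, ‖v‖ = ‖y‖ → h v = h y := by
    intro v hv
    -- The reflection of E along ι (v - y) is intertwined by P with the reflection of H along v - y,
    -- so the invariance of ν passes to H.
    let R : E ≃ₗᵢ[ℝ] E := Submodule.reflection (ℝ ∙ ι (v - y))ᗮ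
    have hRv : R (ι v) = ι y := by
      have := Submodule.reflection_sub (v := ι v) (w := ι y) (by simpa using hv)
      rwa [← map_sub] at this
    have hPR : ∀ x, P (R x) = Submodule.reflection (ℝ ∙ (v - y))ᗮ (P x) := by
      intro x
      simp only [R, Submodule.reflection_orthogonal_apply, Submodule.reflection_singleton_apply]
      rw [map_neg, map_sub, map_nsmul, map_smul, hPι, real_inner_comm, ← hP, real_inner_comm,
        ι.norm_map]
    have hin : ∀ x, inner ℝ (P (R x)) y = inner ℝ (P x) v := by
      intro x
      rw [hP, ← hRv, R.inner_map_map, ← hP]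
    have hpre : R ⁻¹' {x | P x ≠ 0 ∧ t * (‖P x‖ * ‖y‖) ≤ |inner ℝ (P x) y|} =
        {x | P x ≠ 0 ∧ t * (‖P x‖ * ‖v‖) ≤ |inner ℝ (P x) v|} := by
      ext x
      simp only [Set.mem_preimage, Set.mem_ofPred_eq, hin, hv]
      rw [← norm_ne_zero_iff, ← norm_ne_zero_iff (a := P x), hPR, LinearIsometryEquiv.norm_map]
    simp only [hh]
    conv_rhs => rw [← hν R]
    rw [Measure.map_apply R.continuous.measurable (hm y), hpre]
  have hconst : ∀ v : H, v ≠ 0 → h v = h y := by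
    intro v hv
    have hv0 : 0 < ‖v‖ := norm_pos_iff.2 hv
    have hy0 : 0 < ‖y‖ := norm_pos_iff.2 hy
    have hc : 0 < ‖y‖ / ‖v‖ := by positivity
    rw [← hrefl ((‖y‖ / ‖v‖) • v) (by
      rw [norm_smul, Real.norm_eq_abs, abs_of_pos hc]; field_simp)]
    simp only [hh]
    congr 1
    ext x
    simp only [Set.mem_ofPred_eq]
    refine and_congr_right fun _ => ?_
    rw [norm_smul, inner_smul_right, abs_mul, Real.norm_eq_abs, abs_of_pos hc,
      show t * (‖P x‖ * (‖y‖ / ‖v‖ * ‖v‖)) = ‖y‖ / ‖v‖ * (t * (‖P x‖ * ‖v‖)) by ring,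
      mul_le_mul_iff_right₀ hc]
  -- Average `h` over the unit ball of H. As `h` is constant off 0, this is `h y` times the volume;
  -- by Fubini it is also the average of ball-cap volumes, which are the same for every P x ≠ 0.
  set B := Metric.closedBall (0 : H) 1 with hB
  have hB0 : volume B ≠ 0 := (Metric.measure_closedBall_pos volume 0 one_pos).ne'
  have hBt : volume B ≠ ∞ := measure_closedBall_lt_top.ne
  have : Nontrivial H := Module.nontrivial_of_finrank_pos (R := ℝ) (by omega)
  have e1 := Measure.prod_apply (μ := ν) (ν := volume.restrict B) hSm
  have e2 := Measure.prod_apply_symm (μ := ν) (ν := volume.restrict B) hSm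
  rw [e2] at e1
  have l1 : ∫⁻ v in B, ν ((fun x => (x, v)) ⁻¹' ({q : E × H | P q.1 ≠ 0} ∩
      {q : E × H | t * (‖P q.1‖ * ‖q.2‖) ≤ |inner ℝ (P q.1) q.2|})) = h y * volume B := by
    rw [← setLIntegral_const]
    refine lintegral_congr_ae (ae_restrict_of_ae ?_)
    have h0 : ∀ᵐ v : H, v ≠ 0 := by simp [ae_iff]
    exact h0.mono fun v hv => hconst v hv
  have hPm : MeasurableSet {x | P x ≠ 0} :=
    (measurableSet_eq_fun (by fun_prop) (by fun_prop)).compl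
  have l2 : ∫⁻ x, (volume.restrict B) (Prod.mk x ⁻¹' ({q : E × H | P q.1 ≠ 0} ∩
      {q : E × H | t * (‖P q.1‖ * ‖q.2‖) ≤ |inner ℝ (P q.1) q.2|})) ∂ν =
      ENNReal.ofReal (capProb (Module.finrank ℝ H) t) * volume B * ν {x | P x ≠ 0} := by
    rw [← setLIntegral_const, ← lintegral_indicator hPm]
    refine lintegral_congr fun x => ?_
    by_cases hx : P x = 0
    · rw [Set.indicator_of_notMem (by simpa using hx)]
      have : (Prod.mk x ⁻¹' ({q : E × H | P q.1 ≠ 0} ∩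
          {q : E × H | t * (‖P q.1‖ * ‖q.2‖) ≤ |inner ℝ (P q.1) q.2|})) = ∅ := by
        ext v; simp [hx]
      rw [this, measure_empty]
    · rw [Set.indicator_of_mem (by simpa using hx), ← volume_ball_inter_cap hd ht0 ht1 hx,
        Measure.restrict_apply (measurable_prodMk_left hSm), Set.inter_comm]
      congr 1
      ext v
      simp [hx, hB]
  rw [l1, l2] at e1
  have := (ENNReal.mul_left_inj hB0 hBt).1
    (show h y * volume B = (ENNReal.ofReal (capProb (Module.finrank ℝ H) t) *
      ν {x | P x ≠ 0}) * volume B by rw [e1]; ring)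
  exact this

/-- A rotation invariant law without mass at the origin does not charge lines. -/
lemma measure_span_singleton_of_rotation_invariant (ν : Measure E) [IsProbabilityMeasure ν]
    (hν : ∀ R : E ≃ₗᵢ[ℝ] E, ν.map R = ν) (hν0 : ν {0} = 0) (hd : 3 ≤ Module.finrank ℝ E)
    {u : E} (hu : u ≠ 0) : ν ((ℝ ∙ u : Submodule ℝ E) : Set E) = 0 := by
  -- Apart from the origin, a line lies in every cap around itself with t < 1, and the cap
  -- probability vanishes as t → 1.
  have hle : ∀ t ∈ Set.Ioo (0 : ℝ) 1, ν ((ℝ ∙ u : Submodule ℝ E) : Set E) ≤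
      ENNReal.ofReal (capProb (Module.finrank ℝ E) t) := by
    intro t ht
    have h := measure_cap_of_rotation_invariant ν hν LinearIsometry.id
      (ContinuousLinearMap.id ℝ E) (fun _ _ => rfl) (by omega) ht.1.le ht.2 hu
    have hsub : ((ℝ ∙ u : Submodule ℝ E) : Set E) ⊆ {0} ∪ {x | ContinuousLinearMap.id ℝ E x ≠ 0 ∧
        t * (‖ContinuousLinearMap.id ℝ E x‖ * ‖u‖) ≤
          |inner ℝ (ContinuousLinearMap.id ℝ E x) u|} := by
      intro x hx
      obtain ⟨c, rfl⟩ := Submodule.mem_span_singleton.1 hx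
      by_cases hc : c • u = 0
      · exact Or.inl hc
      · refine Or.inr ⟨hc, ?_⟩
        simp only [ContinuousLinearMap.coe_id', id_eq]
        rw [inner_smul_left, norm_smul, real_inner_self_eq_norm_sq, abs_mul, abs_pow, abs_norm]
        simp only [conj_trivial, Real.norm_eq_abs]
        have : 0 ≤ |c| * ‖u‖ ^ 2 := by positivity
        nlinarith [ht.1, ht.2]
    refine (measure_mono hsub).trans ((measure_union_le _ _).trans ?_)
    rw [hν0, zero_add, h]
    exact mul_le_of_le_one_right' prob_le_one
  have hlim : Tendsto (fun t => ENNReal.ofReal (capProb (Module.finrank ℝ E) t)) (𝓝[<] 1)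
      (𝓝 0) := by
    simpa using ENNReal.tendsto_ofReal (tendsto_capProb_one hd)
  refine le_antisymm (ge_of_tendsto hlim ?_) zero_le
  filter_upwards [Ioo_mem_nhdsLT (show (0 : ℝ) < 1 by norm_num)] with t ht using hle t ht

end

/-! ### Correlation as a cosine, and the probabilities of pair events -/

section pearson

variable {n : ℕ}

/-- The orthogonal projection of `ℝⁿ` onto the orthogonal complement of the constant vectors. -/
noncomputable def centering (n : ℕ) :
    EuclideanSpace ℝ (Fin n) →L[ℝ] (ℝ ∙ (WithLp.toLp 2 fun _ : Fin n => (1 : ℝ)))ᗮ :=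
  Submodule.orthogonalProjectionOnto _

lemma coe_centering_apply (x : Fin n → ℝ) (i : Fin n) :
    (centering n (WithLp.toLp 2 x) : EuclideanSpace ℝ (Fin n)) i = x i - sampleMean x := by
  rw [centering, ← Submodule.starProjection_apply, Submodule.starProjection_orthogonal',
    sub_apply, Submodule.starProjection_singleton]
  simp [EuclideanSpace.norm_sq_eq, PiLp.inner_apply, sampleMean]

lemma toLp_one_ne_zero (hn : 0 < n) : (WithLp.toLp 2 fun _ : Fin n => (1 : ℝ)) ≠ 0 := by
  intro h
  have := congrArg (fun v : EuclideanSpace ℝ (Fin n) => v ⟨0, hn⟩) h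
  simp at this

lemma measurable_mulVec (O : Matrix (Fin n) (Fin n) ℝ) :
    Measurable fun x : Fin n → ℝ => O *ᵥ x :=
  (Continuous.matrix_mulVec continuous_const continuous_id).measurable

lemma centering_eq_zero_iff (x : EuclideanSpace ℝ (Fin n)) :
    centering n x = 0 ↔ x ∈ ℝ ∙ (WithLp.toLp 2 fun _ : Fin n => (1 : ℝ)) := by
  rw [centering, Submodule.orthogonalProjectionOnto_eq_zero_iff,
    Submodule.orthogonal_orthogonal]

lemma pearson_eq_inner (x y : Fin n → ℝ) :
    pearson x y = inner ℝ (centering n (WithLp.toLp 2 x)) (centering n (WithLp.toLp 2 y)) /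
      (‖centering n (WithLp.toLp 2 x)‖ * ‖centering n (WithLp.toLp 2 y)‖) := by
  rw [pearson, Real.sqrt_mul (Finset.sum_nonneg fun i _ => sq_nonneg _), Submodule.coe_inner,
    PiLp.inner_apply, Submodule.coe_norm, Submodule.coe_norm, EuclideanSpace.norm_eq,
    EuclideanSpace.norm_eq]
  simp only [coe_centering_apply, Real.norm_eq_abs, sq_abs]
  congr 1
  refine Finset.sum_congr rfl fun i _ => ?_
  simp [mul_comm]

/-- If the centred x vanishes, division by zero makes the correlation 0, below t; the inequality on
the right would hold trivially, so this case is excluded there. -/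
lemma le_abs_pearson_iff {t : ℝ} (ht : 0 < t) {x y : Fin n → ℝ}
    (hy : centering n (WithLp.toLp 2 y) ≠ 0) :
    t ≤ |pearson x y| ↔ centering n (WithLp.toLp 2 x) ≠ 0 ∧
      t * (‖centering n (WithLp.toLp 2 x)‖ * ‖centering n (WithLp.toLp 2 y)‖) ≤
        |inner ℝ (centering n (WithLp.toLp 2 x)) (centering n (WithLp.toLp 2 y))| := by
  rw [pearson_eq_inner]
  by_cases hx : centering n (WithLp.toLp 2 x) = 0
  · simp [hx, ht]
  · have h1 := norm_pos_iff.2 hx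
    have h2 := norm_pos_iff.2 hy
    rw [abs_div, abs_of_pos (mul_pos h1 h2), le_div_iff₀ (mul_pos h1 h2)]
    simp [hx]

lemma pearson_comm (x y : Fin n → ℝ) : pearson x y = pearson y x := by
  simp only [pearson, mul_comm]

lemma measurable_pearson :
    Measurable fun q : (Fin n → ℝ) × (Fin n → ℝ) => pearson q.1 q.2 := by
  unfold pearson sampleMean
  fun_prop

/-- The matrix of R in the standard basis links invariance under orthogonal matrices to invariance
under linear isometries. -/
lemma exists_orthogonal_mulVec (R : EuclideanSpace ℝ (Fin n) ≃ₗᵢ[ℝ] EuclideanSpace ℝ (Fin n)) :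
    ∃ O ∈ Matrix.orthogonalGroup (Fin n) ℝ, ∀ x, WithLp.toLp 2 (O *ᵥ x) = R (WithLp.toLp 2 x) := by
  let b := EuclideanSpace.basisFun (Fin n) ℝ
  refine ⟨LinearMap.toMatrix b.toBasis b.toBasis R.toLinearEquiv.toLinearMap,
    R.toMatrix_mem_unitaryGroup b b, fun x => ?_⟩
  have h := LinearMap.toMatrix_mulVec_repr b.toBasis b.toBasis R.toLinearEquiv.toLinearMap
    (WithLp.toLp 2 x)
  have hb : ∀ y : EuclideanSpace ℝ (Fin n), (b.toBasis.repr y : Fin n → ℝ) = y.ofLp := by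
    intro y; ext i; simp [b]
  rw [hb, hb] at h
  rw [h]
  rfl

section law

variable (ν : Measure (Fin n → ℝ))
  (hν : ∀ O ∈ Matrix.orthogonalGroup (Fin n) ℝ, ν.map (fun x => O *ᵥ x) = ν) (hν0 : ν {0} = 0)

include hν in
lemma map_toLp_rotation_invariant
    (R : EuclideanSpace ℝ (Fin n) ≃ₗᵢ[ℝ] EuclideanSpace ℝ (Fin n)) :
    (ν.map (WithLp.toLp 2)).map R = ν.map (WithLp.toLp 2) := by
  obtain ⟨O, hO, hR⟩ := exists_orthogonal_mulVec R
  have hm : Measurable (WithLp.toLp 2 : (Fin n → ℝ) → EuclideanSpace ℝ (Fin n)) := by fun_prop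
  rw [Measure.map_map R.continuous.measurable hm]
  conv_rhs => rw [← hν O hO]
  rw [Measure.map_map hm (measurable_mulVec O)]
  congr 1
  ext1 x
  exact (hR x).symm

variable [IsProbabilityMeasure ν]

include hν hν0 in
-- The kernel of the centring is the line of constants, and the law charges no line.
lemma measure_centering_eq_zero (hn : 3 ≤ n) :
    ν {x | centering n (WithLp.toLp 2 x) = 0} = 0 := by
  have hm : Measurable (WithLp.toLp 2 : (Fin n → ℝ) → EuclideanSpace ℝ (Fin n)) := by fun_prop
  have : IsProbabilityMeasure (ν.map (WithLp.toLp 2 : _ → EuclideanSpace ℝ (Fin n))) :=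
    Measure.isProbabilityMeasure_map hm.aemeasurable
  have h0 : (ν.map (WithLp.toLp 2 : _ → EuclideanSpace ℝ (Fin n))) {0} = 0 := by
    rw [Measure.map_apply hm (measurableSet_singleton 0), ← hν0]
    congr 1
    ext x
    simp
  have hu := toLp_one_ne_zero (n := n) (by omega)
  have h := measure_span_singleton_of_rotation_invariant _ (map_toLp_rotation_invariant ν hν) h0
    (by rw [finrank_euclideanSpace_fin]; exact hn) hu
  have hset : MeasurableSet ((ℝ ∙ (WithLp.toLp 2 fun _ : Fin n => (1 : ℝ)) :
      Submodule ℝ (EuclideanSpace ℝ (Fin n))) : Set (EuclideanSpace ℝ (Fin n))) :=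
    (Submodule.closed_of_finiteDimensional _).measurableSet
  rw [Measure.map_apply hm hset] at h
  rw [← h]
  congr 1
  ext x
  simp [centering_eq_zero_iff]

include hν hν0 in
lemma measure_le_abs_pearson (hn : 3 ≤ n) {t : ℝ} (ht0 : 0 < t) (ht1 : t < 1) {y : Fin n → ℝ}
    (hy : centering n (WithLp.toLp 2 y) ≠ 0) :
    ν {x | t ≤ |pearson x y|} = ENNReal.ofReal (capProb (n - 1) t) := by
  have hm : Measurable (WithLp.toLp 2 : (Fin n → ℝ) → EuclideanSpace ℝ (Fin n)) := by fun_prop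
  have : IsProbabilityMeasure (ν.map (WithLp.toLp 2 : _ → EuclideanSpace ℝ (Fin n))) :=
    Measure.isProbabilityMeasure_map hm.aemeasurable
  have hu := toLp_one_ne_zero (n := n) (by omega)
  have hdim : Module.finrank ℝ (ℝ ∙ (WithLp.toLp 2 fun _ : Fin n => (1 : ℝ)))ᗮ = n - 1 := by
    have h := Submodule.finrank_add_finrank_orthogonal
      (ℝ ∙ (WithLp.toLp 2 fun _ : Fin n => (1 : ℝ)))
    rw [finrank_span_singleton hu, finrank_euclideanSpace_fin] at h
    omega
  have h := measure_cap_of_rotation_invariant _ (map_toLp_rotation_invariant ν hν)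
    (Submodule.subtypeₗᵢ _) (centering n)
    (fun x v => Submodule.inner_orthogonalProjectionOnto_eq_of_mem_right v x)
    (by rw [hdim]; omega) ht0.le ht1 hy
  rw [hdim] at h
  have hne : MeasurableSet {x | centering n x ≠ 0} :=
    (measurableSet_eq_fun (by fun_prop) (by fun_prop)).compl
  have hle : MeasurableSet {x | t * (‖centering n x‖ * ‖centering n (WithLp.toLp 2 y)‖) ≤
      |inner ℝ (centering n x) (centering n (WithLp.toLp 2 y))|} :=
    measurableSet_le (by fun_prop) (by fun_prop)
  have hset := hne.inter hle
  have hone : ν (WithLp.toLp 2 ⁻¹' {x | centering n x ≠ 0}) = 1 := by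
    rw [← prob_compl_eq_zero_iff (hm hne), ← measure_centering_eq_zero ν hν hν0 hn]
    congr 1
    ext x
    simp
  rw [Set.ofPred_and, Measure.map_apply hm hset, Measure.map_apply hm hne, hone, mul_one] at h
  rw [← h]
  congr 1
  ext x
  exact le_abs_pearson_iff ht0 hy

end law

section columns

variable {Ω : Type*} [MeasurableSpace Ω] {μ : Measure Ω} {p : ℕ}
  {X : Fin p → Ω → Fin n → ℝ}

lemma measurableSet_le_abs_pearson (t : ℝ) :
    MeasurableSet {q : (Fin n → ℝ) × (Fin n → ℝ) | t ≤ |pearson q.1 q.2|} :=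
  measurableSet_le measurable_const measurable_pearson.abs

lemma HasSphericalColumns.measurableSet_pair (hX : HasSphericalColumns μ X) (t : ℝ)
    (i j : Fin p) : MeasurableSet {ω | t ≤ |pearson (X i ω) (X j ω)|} :=
  ((hX.measurable i).prodMk (hX.measurable j)) (measurableSet_le_abs_pearson t)

variable [IsProbabilityMeasure μ]

lemma HasSphericalColumns.measure_le_abs_pearson (hX : HasSphericalColumns μ X) (hn : 3 ≤ n)
    {t : ℝ} (ht0 : 0 < t) (ht1 : t < 1) (i : Fin p) :
    ∀ᵐ y ∂(μ.map (X i)), ∀ j, (μ.map (X j)) {x | t ≤ |pearson x y|} =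
      ENNReal.ofReal (capProb (n - 1) t) := by
  have hprob : ∀ j, IsProbabilityMeasure (μ.map (X j)) := fun j =>
    Measure.isProbabilityMeasure_map (hX.measurable j).aemeasurable
  have hinv : ∀ j, ∀ O ∈ Matrix.orthogonalGroup (Fin n) ℝ,
      (μ.map (X j)).map (fun x => O *ᵥ x) = μ.map (X j) := fun j O hO => by
    rw [Measure.map_map (measurable_mulVec O)
      (hX.measurable j)]
    exact hX.spherical j O hO
  have h0 : ∀ j, (μ.map (X j)) {0} = 0 := fun j => by
    rw [Measure.map_apply (hX.measurable j) (measurableSet_singleton 0)]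
    exact hX.ne_zero j
  have hae : ∀ᵐ y ∂(μ.map (X i)), centering n (WithLp.toLp 2 y) ≠ 0 := by
    rw [ae_iff]
    simpa using measure_centering_eq_zero _ (hinv i) (h0 i) hn
  filter_upwards [hae] with y hy j
  exact _root_.measure_le_abs_pearson _ (hinv j) (h0 j) hn ht0 ht1 hy

lemma HasSphericalColumns.measure_pair (hX : HasSphericalColumns μ X) (hn : 3 ≤ n)
    {t : ℝ} (ht0 : 0 < t) (ht1 : t < 1) {i j : Fin p} (hij : i ≠ j) :
    μ {ω | t ≤ |pearson (X i ω) (X j ω)|} = ENNReal.ofReal (capProb (n - 1) t) := by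
  have hm := measurableSet_le_abs_pearson (n := n) t
  have hprob : IsProbabilityMeasure (μ.map (X j)) :=
    Measure.isProbabilityMeasure_map (hX.measurable j).aemeasurable
  have h := Measure.map_apply (μ := μ) ((hX.measurable i).prodMk (hX.measurable j)) hm
  rw [(hX.indep.indepFun hij).map_prod_eq_prod_map_map (hX.measurable i).aemeasurable
    (hX.measurable j).aemeasurable, Measure.prod_apply_symm hm] at h
  change ∫⁻ y, (μ.map (X i)) {x | t ≤ |pearson x y|} ∂(μ.map (X j)) =
    μ {ω | t ≤ |pearson (X i ω) (X j ω)|} at h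
  rw [← h, lintegral_congr_ae ((hX.measure_le_abs_pearson hn ht0 ht1 j).mono fun y hy => hy i)]
  simp

/-- Given the shared column, the slice is a product set whose two factors have the same probability
for almost every value of that column. -/
lemma HasSphericalColumns.measure_two_pairs (hX : HasSphericalColumns μ X) (hn : 3 ≤ n)
    {t : ℝ} (ht0 : 0 < t) (ht1 : t < 1) {i j k : Fin p} (hij : i ≠ j) (hik : i ≠ k)
    (hkj : k ≠ j) :
    μ ({ω | t ≤ |pearson (X i ω) (X j ω)|} ∩ {ω | t ≤ |pearson (X k ω) (X j ω)|}) =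
      ENNReal.ofReal (capProb (n - 1) t) ^ 2 := by
  have hm := measurableSet_le_abs_pearson (n := n) t
  have hprob : ∀ j, IsProbabilityMeasure (μ.map (X j)) := fun j =>
    Measure.isProbabilityMeasure_map (hX.measurable j).aemeasurable
  have hmi := hX.measurable i
  have hmj := hX.measurable j
  have hmk := hX.measurable k
  set S : Set (((Fin n → ℝ) × (Fin n → ℝ)) × (Fin n → ℝ)) :=
    {q | t ≤ |pearson q.1.1 q.2|} ∩ {q | t ≤ |pearson q.1.2 q.2|} with hS
  have hSm : MeasurableSet S :=
    MeasurableSet.inter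
      ((measurable_fst.fst.prodMk measurable_snd :
        Measurable fun q : ((Fin n → ℝ) × (Fin n → ℝ)) × (Fin n → ℝ) => (q.1.1, q.2)) hm)
      ((measurable_fst.snd.prodMk measurable_snd :
        Measurable fun q : ((Fin n → ℝ) × (Fin n → ℝ)) × (Fin n → ℝ) => (q.1.2, q.2)) hm)
  have h := Measure.map_apply (μ := μ) ((hmi.prodMk hmk).prodMk hmj) hSm
  rw [(hX.indep.indepFun_prodMk hX.measurable i k j hij hkj).map_prod_eq_prod_map_map
    (hmi.prodMk hmk).aemeasurable hmj.aemeasurable,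
    (hX.indep.indepFun hik).map_prod_eq_prod_map_map hmi.aemeasurable hmk.aemeasurable,
    Measure.prod_apply_symm hSm] at h
  change _ = μ ({ω | t ≤ |pearson (X i ω) (X j ω)|} ∩ {ω | t ≤ |pearson (X k ω) (X j ω)|}) at h
  have hslice : ∀ y, (fun q => (q, y)) ⁻¹' S =
      {x | t ≤ |pearson x y|} ×ˢ {x | t ≤ |pearson x y|} := fun y => rfl
  simp only [hslice, Measure.prod_prod] at h
  rw [← h, lintegral_congr_ae ((hX.measure_le_abs_pearson hn ht0 ht1 j).mono fun y hy => by
    rw [hy i, hy k])]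
  simp [sq]

end columns

end pearson

/-! ### Poisson approximation for the coherence -/

section coherence

variable {n p : ℕ}

lemma abs_pearson_le_coherence (x : Fin p → Fin n → ℝ) (q : {q : Fin p × Fin p // q.1 < q.2}) :
    |pearson (x q.1.1) (x q.1.2)| ≤ coherence x :=
  le_ciSup (f := fun q : {q : Fin p × Fin p // q.1 < q.2} => |pearson (x q.1.1) (x q.1.2)|)
    (Set.finite_range _).bddAbove q

/-- Without pairs the supremum is the default value 0, and 0 < t keeps the equivalence true. -/
lemma coherence_lt_iff {t : ℝ} (ht : 0 < t) (x : Fin p → Fin n → ℝ) :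
    coherence x < t ↔
      ∀ q : {q : Fin p × Fin p // q.1 < q.2}, |pearson (x q.1.1) (x q.1.2)| < t := by
  refine ⟨fun h q => (abs_pearson_le_coherence x q).trans_lt h, fun h => ?_⟩
  rcases isEmpty_or_nonempty {q : Fin p × Fin p // q.1 < q.2} with he | he
  · rwa [coherence, Real.iSup_of_isEmpty]
  · obtain ⟨q, hq⟩ := exists_eq_ciSup_of_finite
      (f := fun q : {q : Fin p × Fin p // q.1 < q.2} => |pearson (x q.1.1) (x q.1.2)|)
    rw [coherence, ← hq]
    exact h q

lemma coherence_nonneg (x : Fin p → Fin n → ℝ) : 0 ≤ coherence x :=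
  Real.iSup_nonneg fun _ => abs_nonneg _

lemma measurable_coherence : Measurable (coherence : (Fin p → Fin n → ℝ) → ℝ) := by
  unfold coherence
  refine Measurable.iSup fun q => ?_
  have h : Measurable fun x : Fin p → Fin n → ℝ => (x q.1.1, x q.1.2) :=
    (measurable_pi_apply q.1.1).prodMk (measurable_pi_apply q.1.2)
  exact continuous_abs.measurable.comp (measurable_pearson.comp h)

lemma card_pairs : (Fintype.card {q : Fin p × Fin p // q.1 < q.2} : ℝ) = p * (p - 1) / 2 := by
  have h : Fintype.card {q : Fin p × Fin p // q.1 < q.2} = ∑ i ∈ Finset.range p, i := by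
    rw [Fintype.card_subtype, Finset.card_filter, ← Finset.univ_product_univ,
      Finset.sum_product_right, ← Fin.sum_univ_eq_sum_range (fun i => i)]
    refine Finset.sum_congr rfl fun j _ => ?_
    rw [← Finset.card_filter, ← Fin.card_Iio j]
    congr 1
    ext i
    simp
  have h2 := Finset.sum_range_id_mul_two p
  rw [← h] at h2
  rcases Nat.eq_zero_or_pos p with rfl | hp
  · simp
  · have h3 : ((Fintype.card {q : Fin p × Fin p // q.1 < q.2} : ℕ) : ℝ) * 2 =
        p * ((p - 1 : ℕ) : ℝ) := by exact_mod_cast h2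
    rw [Nat.cast_sub hp, Nat.cast_one] at h3
    linarith

/-- The set of the two endpoints of a pair. -/
def pairEnds (α : {q : Fin p × Fin p // q.1 < q.2}) : Finset (Fin p) := {α.1.1, α.1.2}

lemma card_pairs_not_disjoint_le (α : {q : Fin p × Fin p // q.1 < q.2}) :
    (Finset.univ.filter fun β => ¬ Disjoint (pairEnds α) (pairEnds β)).card ≤ 4 * p := by
  have hends : (pairEnds α).card ≤ 2 := Finset.card_le_two
  -- A pair meeting α has its first or second entry among the ends of α: two strips of at most 2p
  -- elements each.
  have hsub : (Finset.univ.filter fun β => ¬ Disjoint (pairEnds α) (pairEnds β)).map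
      (Function.Embedding.subtype _) ⊆
      pairEnds α ×ˢ Finset.univ ∪ Finset.univ ×ˢ pairEnds α := by
    intro q hq
    simp only [Finset.mem_map, Finset.mem_filter, Finset.mem_univ, true_and,
      Finset.not_disjoint_iff] at hq
    obtain ⟨β, ⟨a, ha, hb⟩, rfl⟩ := hq
    simp only [pairEnds, Finset.mem_insert, Finset.mem_singleton] at hb
    simp only [Finset.mem_union, Finset.mem_product, Finset.mem_univ, and_true, true_and,
      Function.Embedding.subtype_apply]
    rcases hb with rfl | rfl
    · exact Or.inl ha
    · exact Or.inr ha
  have h := Finset.card_le_card hsub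
  rw [Finset.card_map] at h
  refine h.trans ((Finset.card_union_le _ _).trans ?_)
  rw [Finset.card_product, Finset.card_product, Finset.card_univ, Fintype.card_fin]
  nlinarith

variable {Ω : Type*} [MeasurableSpace Ω] {μ : Measure Ω} {X : Fin p → Ω → Fin n → ℝ}

/-- The two variables are functions of disjoint groups of columns: the ends of α, and all the
others. -/
lemma HasSphericalColumns.indepFun_pairs (hX : HasSphericalColumns μ X) (t : ℝ)
    (α : {q : Fin p × Fin p // q.1 < q.2}) (D : Finset {q : Fin p × Fin p // q.1 < q.2})
    (hD : ∀ β ∈ D, Disjoint (pairEnds α) (pairEnds β)) :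
    IndepFun ({ω | t ≤ |pearson (X α.1.1 ω) (X α.1.2 ω)|}.indicator (1 : Ω → ℕ))
      (fun ω => ∑ β ∈ D, {ω | t ≤ |pearson (X β.1.1 ω) (X β.1.2 ω)|}.indicator (1 : Ω → ℕ) ω)
      μ := by
  have h := hX.indep.indepFun_finset (pairEnds α) (pairEnds α)ᶜ disjoint_compl_right hX.measurable
  have hα1 : α.1.1 ∈ pairEnds α := by simp [pairEnds]
  have hα2 : α.1.2 ∈ pairEnds α := by simp [pairEnds]
  have hβ1 : ∀ β ∈ D, β.1.1 ∈ (pairEnds α)ᶜ := fun β hβ =>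
    Finset.mem_compl.2 fun h => Finset.disjoint_left.1 (hD β hβ) h (by simp [pairEnds])
  have hβ2 : ∀ β ∈ D, β.1.2 ∈ (pairEnds α)ᶜ := fun β hβ =>
    Finset.mem_compl.2 fun h => Finset.disjoint_left.1 (hD β hβ) h (by simp [pairEnds])
  set S : Set ((Fin n → ℝ) × (Fin n → ℝ)) := {q | t ≤ |pearson q.1 q.2|} with hS
  have hSm : MeasurableSet S := measurableSet_le_abs_pearson t
  have hind : Measurable (S.indicator (1 : (Fin n → ℝ) × (Fin n → ℝ) → ℕ)) :=
    measurable_one.indicator hSm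
  have hφ : Measurable fun z : pairEnds α → Fin n → ℝ =>
      S.indicator (1 : (Fin n → ℝ) × (Fin n → ℝ) → ℕ) (z ⟨_, hα1⟩, z ⟨_, hα2⟩) :=
    hind.comp ((measurable_pi_apply _).prodMk (measurable_pi_apply _))
  have hψ : Measurable fun z : ((pairEnds α)ᶜ : Finset (Fin p)) → Fin n → ℝ =>
      ∑ β ∈ D.attach, S.indicator (1 : (Fin n → ℝ) × (Fin n → ℝ) → ℕ)
        (z ⟨_, hβ1 β β.2⟩, z ⟨_, hβ2 β β.2⟩) :=
    Finset.measurable_sum _ fun β _ =>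
      hind.comp ((measurable_pi_apply _).prodMk (measurable_pi_apply _))
  have h2 := h.comp hφ hψ
  have e : (fun ω => ∑ β ∈ D,
      {ω | t ≤ |pearson (X β.1.1 ω) (X β.1.2 ω)|}.indicator (1 : Ω → ℕ) ω) =
      (fun z : ((pairEnds α)ᶜ : Finset (Fin p)) → Fin n → ℝ =>
      ∑ β ∈ D.attach, S.indicator (1 : (Fin n → ℝ) × (Fin n → ℝ) → ℕ)
        (z ⟨_, hβ1 β β.2⟩, z ⟨_, hβ2 β β.2⟩)) ∘
        fun a (i : ((pairEnds α)ᶜ : Finset (Fin p))) => X i a := by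
    ext ω
    rw [← Finset.sum_attach]
    rfl
  rw [e]
  exact h2

variable [IsProbabilityMeasure μ]

lemma HasSphericalColumns.measure_inter_pairs (hX : HasSphericalColumns μ X) (hn : 3 ≤ n)
    {t : ℝ} (ht0 : 0 < t) (ht1 : t < 1) {α β : {q : Fin p × Fin p // q.1 < q.2}} (hαβ : β ≠ α)
    (hd : ¬ Disjoint (pairEnds α) (pairEnds β)) :
    μ ({ω | t ≤ |pearson (X α.1.1 ω) (X α.1.2 ω)|} ∩
      {ω | t ≤ |pearson (X β.1.1 ω) (X β.1.2 ω)|}) = ENNReal.ofReal (capProb (n - 1) t) ^ 2 := by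
  obtain ⟨⟨a, b⟩, hab : a < b⟩ := α
  obtain ⟨⟨c, d⟩, hcd : c < d⟩ := β
  have hcomm : ∀ i j, {ω | t ≤ |pearson (X i ω) (X j ω)|} =
      {ω | t ≤ |pearson (X j ω) (X i ω)|} := fun i j => by
    ext ω; rw [Set.mem_ofPred_eq, Set.mem_ofPred_eq, pearson_comm]
  have hne : ¬ (c = a ∧ d = b) := fun h => hαβ (by ext <;> simp [h.1, h.2])
  simp only [pairEnds, Finset.not_disjoint_iff, Finset.mem_insert, Finset.mem_singleton] at hd
  dsimp only
  -- Symmetry of the correlation moves the shared column to second place. The other two columns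
  -- differ because the pairs do if the shared position is the same, and by the ordering otherwise.
  obtain ⟨e, rfl | rfl, rfl | rfl⟩ := hd
  · rw [hcomm e b, hcomm e d]
    exact hX.measure_two_pairs hn ht0 ht1 hab.ne' (fun h => hne ⟨rfl, h.symm⟩) hcd.ne'
  · rw [hcomm e b]
    exact hX.measure_two_pairs hn ht0 ht1 hab.ne' (hcd.trans hab).ne' hcd.ne
  · rw [hcomm e d]
    exact hX.measure_two_pairs hn ht0 ht1 hab.ne (hab.trans hcd).ne hcd.ne'
  · exact hX.measure_two_pairs hn ht0 ht1 hab.ne (fun h => hne ⟨h.symm, rfl⟩) hcd.ne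

/-- Poisson approximation of the distribution function of the coherence. -/
theorem HasSphericalColumns.abs_measureReal_coherence_lt_sub_exp_le
    (hX : HasSphericalColumns μ X) (hn : 3 ≤ n) {t : ℝ} (ht0 : 0 < t) (ht1 : t < 1) :
    |μ.real {ω | coherence (fun j => X j ω) < t} -
      Real.exp (-((p * (p - 1) / 2 : ℝ) * capProb (n - 1) t))| ≤
      4 * p ^ 3 * capProb (n - 1) t ^ 2 := by
  set q := capProb (n - 1) t with hq
  have hq0 : 0 ≤ q := capProb_nonneg _ _
  let A : {q : Fin p × Fin p // q.1 < q.2} → Set Ω := fun α =>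
    {ω | t ≤ |pearson (X α.1.1 ω) (X α.1.2 ω)|}
  let B : {q : Fin p × Fin p // q.1 < q.2} → Finset {q : Fin p × Fin p // q.1 < q.2} := fun α =>
    Finset.univ.filter fun β => ¬ Disjoint (pairEnds α) (pairEnds β)
  have hA : ∀ α, μ.real (A α) = q := fun α => by
    rw [measureReal_def, hX.measure_pair hn ht0 ht1 α.2.ne, ENNReal.toReal_ofReal hq0]
  have hAA : ∀ α, ∀ β ∈ (B α).erase α, μ.real (A α ∩ A β) = q ^ 2 := fun α β hβ => by
    rw [Finset.mem_erase, Finset.mem_filter] at hβ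
    rw [measureReal_def, hX.measure_inter_pairs hn ht0 ht1 hβ.1 hβ.2.2, ENNReal.toReal_pow,
      ENNReal.toReal_ofReal hq0]
  have h := abs_measureReal_none_sub_exp_le μ A (fun α => hX.measurableSet_pair t _ _) B
    (fun α => by simp [B, pairEnds]) (fun α => hX.indepFun_pairs t α _ fun β hβ => by
      simpa [B] using hβ)
  have hset : (⋂ α, (A α)ᶜ) = {ω | coherence (fun j => X j ω) < t} := by
    ext ω
    simp [A, coherence_lt_iff ht0]
  have hcard : ∀ α, ((B α).card : ℝ) ≤ 4 * p := fun α => by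
    exact_mod_cast card_pairs_not_disjoint_le α
  have hcard' : ∀ α, (((B α).erase α).card : ℝ) ≤ 4 * p := fun α =>
    le_trans (by exact_mod_cast Finset.card_erase_le) (hcard α)
  rw [hset] at h
  simp only [hA, Finset.sum_const, nsmul_eq_mul, Finset.card_univ, card_pairs] at h
  refine h.trans ?_
  rw [Finset.sum_congr rfl fun α _ => Finset.sum_congr rfl (hAA α)]
  simp only [Finset.sum_const, nsmul_eq_mul]
  have h1 : ∑ α, ((B α).card : ℝ) * (q * q) ≤ (p * (p - 1) / 2) * (4 * p * (q * q)) := by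
    rw [← card_pairs, ← nsmul_eq_mul, ← Finset.card_univ, ← Finset.sum_const]
    exact Finset.sum_le_sum fun α _ => mul_le_mul_of_nonneg_right (hcard α) (by positivity)
  have h2 : ∑ α, (((B α).erase α).card : ℝ) * q ^ 2 ≤ (p * (p - 1) / 2) * (4 * p * q ^ 2) := by
    rw [← card_pairs, ← nsmul_eq_mul, ← Finset.card_univ, ← Finset.sum_const]
    exact Finset.sum_le_sum fun α _ => mul_le_mul_of_nonneg_right (hcard' α) (by positivity)
  -- The two sums total at most 4p²(p - 1)q²; this discards the term -4p²q².
  have h3 : 0 ≤ (p : ℝ) ^ 2 * q ^ 2 := by positivity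
  nlinarith

end coherence

/-! ### Asymptotics of the cap probability at the threshold -/

lemma tendsto_cauchyTail_mul_div {a τ : ℕ → ℝ} {σ : ℝ} (hσ : 0 < σ)
    (ha : Tendsto a atTop atTop) (hτ : Tendsto τ atTop (𝓝 σ)) :
    Tendsto (fun n => cauchyTail (a n) (τ n) * (2 * (a n - 1) * τ n) /
      (1 + τ n ^ 2) ^ (1 - a n)) atTop (𝓝 1) := by
  have ha1 : Tendsto (fun n => 2 * (a n - 1)) atTop atTop :=
    (tendsto_atTop_add_const_right _ (-1) ha).const_mul_atTop two_pos
  have hlow : Tendsto (fun n => (1 + (1 + (τ n ^ 2)⁻¹) / (2 * (a n - 1)))⁻¹) atTop (𝓝 1) := by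
    have h1 : Tendsto (fun n => 1 + (τ n ^ 2)⁻¹) atTop (𝓝 (1 + (σ ^ 2)⁻¹)) :=
      ((hτ.pow 2).inv₀ (by positivity)).const_add 1
    have h2 := ((h1.div_atTop ha1).const_add 1).inv₀ (by norm_num)
    simpa using h2
  refine tendsto_of_tendsto_of_tendsto_of_le_of_le' hlow tendsto_const_nhds ?_ ?_
  · filter_upwards [ha.eventually_gt_atTop 1, hτ.eventually_const_lt hσ] with n h1 h2
    have ha' : 0 < a n - 1 := by linarith
    have h := le_cauchyTail h1 h2
    rw [div_le_iff₀ (by positivity)] at h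
    rw [le_div_iff₀ (by positivity), inv_mul_le_iff₀ (by positivity)]
    linarith
  · filter_upwards [ha.eventually_gt_atTop 1, hτ.eventually_const_lt hσ] with n h1 h2
    have ha' : 0 < a n - 1 := by linarith
    have h := cauchyTail_le h1 h2
    rw [le_div_iff₀ (by positivity)] at h
    rwa [div_le_one (by positivity)]

section threshold

variable {p : ℕ → ℕ} {β : ℝ}

/-- The value `s` such that `1 - L ^ 2 ≤ exp (-s)` is the event
`n * log (1 - L ^ 2) + 4 * log p - log (log p) ≤ y`. -/
noncomputable def logThreshold (p : ℕ → ℕ) (y : ℝ) (n : ℕ) : ℝ :=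
  (4 * Real.log (p n) - Real.log (Real.log (p n)) - y) / n

/-- The level that the coherence reaches if and only if
`n * log (1 - L ^ 2) + 4 * log p - log (log p) ≤ y`. -/
noncomputable def threshold (p : ℕ → ℕ) (y : ℝ) (n : ℕ) : ℝ :=
  √(1 - Real.exp (-logThreshold p y n))

variable (hβ : 0 < β) (hp : Tendsto (fun n : ℕ => Real.log (p n) / n) atTop (𝓝 β))

include hβ hp

lemma tendsto_log_atTop : Tendsto (fun n => Real.log (p n)) atTop atTop := by
  have h := hp.pos_mul_atTop hβ tendsto_natCast_atTop_atTop
  refine h.congr' ?_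
  filter_upwards [eventually_gt_atTop 0] with n hn
  field_simp

lemma tendsto_natCast_real_atTop : Tendsto (fun n => (p n : ℝ)) atTop atTop := by
  refine tendsto_atTop_mono (fun n => ?_) (tendsto_log_atTop hβ hp)
  exact Real.log_le_self (Nat.cast_nonneg _)

/-- As log p has order n, both log log p and y are negligible, so the limit is the same for all y.
-/
lemma tendsto_logThreshold (y : ℝ) : Tendsto (logThreshold p y) atTop (𝓝 (4 * β)) := by
  have h1 : Tendsto (fun n => Real.log (Real.log (p n)) / Real.log (p n)) atTop (𝓝 0) :=
    (Real.isLittleO_log_id_atTop.tendsto_div_nhds_zero).comp (tendsto_log_atTop hβ hp)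
  have h2 := h1.mul hp
  have h3 : Tendsto (fun n : ℕ => y / (n : ℝ)) atTop (𝓝 0) :=
    tendsto_const_nhds.div_atTop tendsto_natCast_atTop_atTop
  have h4 := ((hp.const_mul 4).sub h2).sub h3
  rw [zero_mul, sub_zero, sub_zero] at h4
  refine h4.congr' ?_
  filter_upwards [(tendsto_log_atTop hβ hp).eventually_gt_atTop 0, eventually_gt_atTop 0]
    with n hn hn0
  rw [logThreshold]
  field_simp

lemma tendsto_threshold (y : ℝ) :
    Tendsto (threshold p y) atTop (𝓝 (√(1 - Real.exp (-4 * β)))) := by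
  rw [neg_mul]
  exact ((Real.continuous_exp.tendsto _).comp (tendsto_logThreshold hβ hp y).neg).const_sub 1
    |>.sqrt

lemma eventually_logThreshold_pos (y : ℝ) : ∀ᶠ n in atTop, 0 < logThreshold p y n :=
  (tendsto_logThreshold hβ hp y).eventually_const_lt (by positivity)

omit hβ hp in
lemma threshold_sq {y : ℝ} {n : ℕ} (h : 0 < logThreshold p y n) :
    threshold p y n ^ 2 = 1 - Real.exp (-logThreshold p y n) := by
  refine Real.sq_sqrt ?_
  have : Real.exp (-logThreshold p y n) < 1 := Real.exp_lt_one_iff.2 (by linarith)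
  linarith

omit hβ hp in
lemma threshold_mem_Ioo {y : ℝ} {n : ℕ} (h : 0 < logThreshold p y n) :
    threshold p y n ∈ Set.Ioo (0 : ℝ) 1 := by
  have h1 : Real.exp (-logThreshold p y n) < 1 := Real.exp_lt_one_iff.2 (by linarith)
  have h2 := Real.exp_pos (-logThreshold p y n)
  have h3 : 0 < threshold p y n := Real.sqrt_pos.2 (by linarith)
  refine ⟨h3, ?_⟩
  have := threshold_sq h
  nlinarith

/-- Here 1 + τ² = e^s with s the `logThreshold`, so for a = (n - 1)/2 the power (1 + τ²)^(1 - a)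
equals e^{y/2} e^{3s/2} √(log p) / p². The quotient of 2(a - 1) and `cauchyTail` normalisations
contributes order n^{-1/2}, and √(log p / n) → √β: this is the role of log log p in the centring. -/
lemma tendsto_sq_mul_capProb_threshold (y : ℝ) :
    Tendsto (fun n => (p n : ℝ) ^ 2 / 2 * capProb (n - 1) (threshold p y n)) atTop
      (𝓝 (√(β / (2 * Real.pi * (1 - Real.exp (-4 * β)))) * Real.exp ((y + 8 * β) / 2))) := by
  set s := logThreshold p y with hs
  set τ : ℕ → ℝ := fun n => threshold p y n / √(1 - threshold p y n ^ 2) with hτ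
  set a : ℕ → ℝ := fun n => ((n - 1 : ℕ) : ℝ) / 2 with ha
  have hD : 0 < 1 - Real.exp (-4 * β) := by
    have : Real.exp (-4 * β) < 1 := Real.exp_lt_one_iff.2 (by linarith)
    linarith
  set σ := √(1 - Real.exp (-4 * β)) * Real.exp (2 * β) with hσ
  have hσ0 : 0 < σ := mul_pos (Real.sqrt_pos.2 hD) (Real.exp_pos _)
  have hslim : Tendsto s atTop (𝓝 (4 * β)) := tendsto_logThreshold hβ hp y
  have hτeq : ∀ᶠ n in atTop, threshold p y n * Real.exp (s n / 2) = τ n := by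
    filter_upwards [eventually_logThreshold_pos hβ hp y] with n hn
    simp only [hτ]
    rw [threshold_sq hn, sub_sub_cancel, show -logThreshold p y n =
      -(s n / 2) + -(s n / 2) by simp only [hs]; ring, Real.exp_add,
      Real.sqrt_mul_self (Real.exp_pos _).le, Real.exp_neg, div_inv_eq_mul]
  have hτ2 : ∀ᶠ n in atTop, 1 + τ n ^ 2 = Real.exp (s n) := by
    filter_upwards [eventually_logThreshold_pos hβ hp y, hτeq] with n hn he
    rw [← he, mul_pow, threshold_sq hn, ← Real.exp_nat_mul, sub_mul, ← Real.exp_add]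
    simp only [hs]
    rw [show ((2 : ℕ) : ℝ) * (logThreshold p y n / 2) = logThreshold p y n by push_cast; ring,
      neg_add_cancel, Real.exp_zero]
    ring
  have hτlim : Tendsto τ atTop (𝓝 σ) := by
    have h := (tendsto_threshold hβ hp y).mul
      ((Real.continuous_exp.tendsto _).comp (hslim.div_const 2))
    rw [show 4 * β / 2 = 2 * β by ring] at h
    exact h.congr' hτeq
  have hnat : Tendsto (fun n : ℕ => ((n - 1 : ℕ) : ℝ)) atTop atTop :=
    tendsto_natCast_atTop_atTop.comp (tendsto_sub_atTop_nat 1)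
  have halim : Tendsto a atTop atTop := hnat.atTop_div_const two_pos
  have h1 := tendsto_cauchyTail_mul_div hσ0 halim hτlim
  have h2 := tendsto_sqrt_mul_cauchyTail_zero.comp halim
  have h3 : Tendsto (fun n => Real.exp (y / 2) * Real.exp (3 / 2 * s n)) atTop
      (𝓝 (Real.exp (y / 2) * Real.exp (3 / 2 * (4 * β)))) :=
    ((Real.continuous_exp.tendsto _).comp (hslim.const_mul (3 / 2))).const_mul _
  have hinv : Tendsto (fun n : ℕ => ((n : ℝ))⁻¹) atTop (𝓝 0) :=
    tendsto_inv_atTop_zero.comp tendsto_natCast_atTop_atTop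
  -- This gathers √(log p), √(2a) = √(n - 1) and 2(a - 1) = n - 3.
  have h4 : Tendsto (fun n : ℕ => √(Real.log (p n) / n) *
      (√(1 - (n : ℝ)⁻¹) / (1 - 3 * (n : ℝ)⁻¹))) atTop (𝓝 (√β)) := by
    have h := hp.sqrt.mul (((hinv.const_sub 1).sqrt).div ((hinv.const_mul 3).const_sub 1)
      (by norm_num))
    simpa using h
  have h5 := (((h1.mul h3).mul h4).div (hτlim.mul (h2.const_mul 2))
    (by have : 0 < √(Real.pi / 2) := Real.sqrt_pos.2 (by positivity)
        positivity))
  have hval : 1 * (Real.exp (y / 2) * Real.exp (3 / 2 * (4 * β))) * √β /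
      (σ * (2 * √(Real.pi / 2))) =
      √(β / (2 * Real.pi * (1 - Real.exp (-4 * β)))) * Real.exp ((y + 8 * β) / 2) := by
    have hπ : 2 * √(Real.pi / 2) = √(2 * Real.pi) := by
      rw [show 2 * Real.pi = 2 ^ 2 * (Real.pi / 2) by ring, Real.sqrt_mul (by positivity),
        Real.sqrt_sq (by norm_num)]
    have he : Real.exp (y / 2) * Real.exp (3 / 2 * (4 * β)) =
        Real.exp ((y + 8 * β) / 2) * Real.exp (2 * β) := by
      rw [← Real.exp_add, ← Real.exp_add]; congr 1; ring
    have hD' := Real.sqrt_pos.2 hD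
    have hπ' : 0 < √(2 * Real.pi) := Real.sqrt_pos.2 (by positivity)
    rw [hπ, he, hσ, Real.sqrt_div hβ.le,
      Real.sqrt_mul (show 0 ≤ 2 * Real.pi by positivity)]
    field_simp
  rw [hval] at h5
  refine h5.congr' ?_
  filter_upwards [hτ2, eventually_gt_atTop 3, (tendsto_log_atTop hβ hp).eventually_gt_atTop 0,
    hτlim.eventually_const_lt hσ0] with n hn2 hn hl hτ0
  have hn3 : (3 : ℝ) < n := by exact_mod_cast hn
  have han : a n = ((n : ℝ) - 1) / 2 := by
    simp only [ha]; rw [Nat.cast_sub (by omega), Nat.cast_one]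
  have hp0 : 0 < (p n : ℝ) := by
    rcases (Nat.cast_nonneg (p n) : (0 : ℝ) ≤ p n).eq_or_lt with h | h
    · rw [← h, Real.log_zero] at hl; exact absurd hl (lt_irrefl _)
    · exact h
  have hpow : (1 + τ n ^ 2) ^ (1 - a n) =
      Real.exp (y / 2) * Real.exp (3 / 2 * s n) * √(Real.log (p n)) / (p n : ℝ) ^ 2 := by
    have hsn : s n * n = 4 * Real.log (p n) - Real.log (Real.log (p n)) - y := by
      simp only [hs, logThreshold]; field_simp
    have hsq : √(Real.log (p n)) = Real.exp (Real.log (Real.log (p n)) / 2) := by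
      rw [Real.exp_half, Real.exp_log hl]
    have hpsq : (p n : ℝ) ^ 2 = Real.exp (2 * Real.log (p n)) := by
      rw [mul_comm, Real.exp_mul, Real.exp_log hp0]; norm_cast
    rw [hn2, ← Real.exp_mul, hsq, hpsq, ← Real.exp_add, ← Real.exp_add, ← Real.exp_sub, han]
    congr 1
    linarith
  have hc0 := cauchyTail_zero_pos (a := a n) (by rw [han]; linarith)
  have hsqa : √(2 * a n) = √n * √(1 - (n : ℝ)⁻¹) := by
    rw [← Real.sqrt_mul (by positivity), han]
    congr 1
    field_simp
  have hq : capProb (n - 1) (threshold p y n) = cauchyTail (a n) (τ n) / cauchyTail (a n) 0 := rfl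
  have hs1 : 0 < √(1 - (n : ℝ)⁻¹) := by
    refine Real.sqrt_pos.2 ?_
    have := inv_lt_one_of_one_lt₀ (show (1 : ℝ) < n by linarith)
    linarith
  have hsl : 0 < √(Real.log (p n)) := Real.sqrt_pos.2 hl
  have hsn : √(n : ℝ) * √n = n := Real.mul_self_sqrt (by linarith)
  have hsn0 : 0 < √(n : ℝ) := Real.sqrt_pos.2 (by linarith)
  have ha1 : 2 * (a n - 1) = √(n : ℝ) * √n * (1 - 3 * (n : ℝ)⁻¹) := by
    rw [hsn, han]; field_simp; ring
  have h13 : 0 < 1 - 3 * (n : ℝ)⁻¹ := by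
    rw [← div_eq_mul_inv, sub_pos, div_lt_one (by linarith)]; exact hn3
  simp only [Pi.div_apply, Function.comp_apply]
  rw [hq, hpow, hsqa, ha1, Real.sqrt_div hl.le]
  have := Real.exp_pos (y / 2)
  have := Real.exp_pos (3 / 2 * s n)
  generalize √(1 - (n : ℝ)⁻¹) = u at hs1 ⊢
  generalize 1 - 3 * (n : ℝ)⁻¹ = v at h13 ⊢
  field_simp

lemma tendsto_pairs_mul_capProb_threshold (y : ℝ) :
    Tendsto (fun n => ((p n : ℝ) * (p n - 1) / 2) * capProb (n - 1) (threshold p y n)) atTop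
      (𝓝 (√(β / (2 * Real.pi * (1 - Real.exp (-4 * β)))) * Real.exp ((y + 8 * β) / 2))) := by
  have hpt := tendsto_natCast_real_atTop hβ hp
  have h1 := (tendsto_inv_atTop_zero.comp hpt).const_sub 1
  have h := (tendsto_sq_mul_capProb_threshold hβ hp y).mul h1
  rw [sub_zero, mul_one] at h
  refine h.congr' ?_
  filter_upwards [hpt.eventually_gt_atTop 0] with n hn
  simp only [Function.comp_apply]
  field_simp

/-- It is 16 (p²q/2)² / p, with p²q/2 convergent. -/
lemma tendsto_cube_mul_capProb_threshold_sq (y : ℝ) :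
    Tendsto (fun n => 4 * (p n : ℝ) ^ 3 * capProb (n - 1) (threshold p y n) ^ 2) atTop (𝓝 0) := by
  have hpt := tendsto_natCast_real_atTop hβ hp
  have h := (((tendsto_sq_mul_capProb_threshold hβ hp y).pow 2).mul
    (tendsto_inv_atTop_zero.comp hpt)).const_mul 16
  rw [mul_zero, mul_zero] at h
  refine h.congr' ?_
  filter_upwards [hpt.eventually_gt_atTop 0] with n hn
  simp only [Function.comp_apply]
  field_simp
  ring

end threshold

/-! ### Weak convergence from distribution functions, and the limit law -/

/-- Pointwise convergence of the distribution functions implies convergence in distribution. -/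
theorem tendstoInDistribution_of_tendsto_cdf {Ω : ℕ → Type*} [∀ n, MeasurableSpace (Ω n)]
    {μ : ∀ n, Measure (Ω n)} [∀ n, IsProbabilityMeasure (μ n)] {Z : ∀ n, Ω n → ℝ}
    {ν : Measure ℝ} [IsProbabilityMeasure ν] (hZ : ∀ n, AEMeasurable (Z n) (μ n))
    (h : ∀ y, Tendsto (fun n => (μ n).real {ω | Z n ω ≤ y}) atTop (𝓝 (cdf ν y))) :
    TendstoInDistribution Z atTop id μ ν where
  forall_aemeasurable := hZ
  aemeasurable_limit := aemeasurable_id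
  tendsto := by
    -- Half-open intervals form a π-system with small neighbourhoods of every point, and their
    -- masses are differences of distribution function values.
    have hpi : IsPiSystem {s : Set ℝ | ∃ a b, s = Set.Ioc a b} := by
      rintro _ ⟨a, b, rfl⟩ _ ⟨c, d, rfl⟩ _
      exact ⟨_, _, Set.Ioc_inter_Ioc⟩
    refine hpi.tendsto_probabilityMeasure_of_tendsto_of_mem ?_ ?_ ?_
    · rintro _ ⟨a, b, rfl⟩
      exact measurableSet_Ioc
    · intro u hu x hx
      obtain ⟨ε, hε, hsub⟩ := Metric.isOpen_iff.1 hu x hx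
      refine ⟨Set.Ioc (x - ε / 2) (x + ε / 2), ⟨_, _, rfl⟩,
        Ioc_mem_nhds (by linarith) (by linarith), fun z hz => hsub ?_⟩
      rw [Metric.mem_ball, Real.dist_eq, abs_lt]
      constructor <;> linarith [hz.1, hz.2]
    · rintro _ ⟨a, b, rfl⟩
      rw [← NNReal.tendsto_coe]
      change Tendsto (fun n => ((μ n).map (Z n)).real (Set.Ioc a b)) atTop
        (𝓝 ((ν.map id).real (Set.Ioc a b)))
      rw [Measure.map_id]
      rcases le_or_gt b a with hab | hab
      · simp [Set.Ioc_eq_empty (not_lt.2 hab)]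
      have hdiff : Set.Ioc a b = Set.Iic b \ Set.Iic a := by
        ext z; simp [and_comm]
      have hsub : Set.Iic a ⊆ Set.Iic b := Set.Iic_subset_Iic.2 hab.le
      have hlim : ν.real (Set.Ioc a b) = cdf ν b - cdf ν a := by
        rw [hdiff, measureReal_sdiff hsub measurableSet_Iic, cdf_eq_real, cdf_eq_real]
      rw [hlim]
      refine ((h b).sub (h a)).congr fun n => ?_
      have := Measure.isProbabilityMeasure_map (hZ n)
      have hmap : ∀ y, (μ n).real {ω | Z n ω ≤ y} = ((μ n).map (Z n)).real (Set.Iic y) := by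
        intro y
        rw [measureReal_def, measureReal_def,
          Measure.map_apply_of_aemeasurable (hZ n) measurableSet_Iic]
        rfl
      rw [hmap, hmap, hdiff, measureReal_sdiff hsub measurableSet_Iic]

/-- The law with distribution function `1 - exp (-K exp ((y + c) / 2))`. -/
lemma exists_cdf_eq_one_sub_exp {K : ℝ} (hK : 0 < K) (c : ℝ) :
    ∃ (ν : Measure ℝ) (_ : IsProbabilityMeasure ν),
      ∀ y, cdf ν y = 1 - Real.exp (-(K * Real.exp ((y + c) / 2))) := by
  have hcont : Continuous fun y : ℝ => 1 - Real.exp (-(K * Real.exp ((y + c) / 2))) := by fun_prop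
  let f : StieltjesFunction ℝ :=
    { toFun := fun y => 1 - Real.exp (-(K * Real.exp ((y + c) / 2)))
      mono' := fun x y hxy => by dsimp only; gcongr
      right_continuous' := fun x => hcont.continuousWithinAt }
  have hbot : Tendsto f atBot (𝓝 0) := by
    have h1 : Tendsto (fun y : ℝ => Real.exp ((y + c) / 2)) atBot (𝓝 0) :=
      Real.tendsto_exp_atBot.comp
        ((tendsto_atBot_add_const_right _ c tendsto_id).atBot_div_const two_pos)
    have h2 := ((Real.continuous_exp.tendsto _).comp (h1.const_mul K).neg).const_sub 1
    simp only [mul_zero, neg_zero, Real.exp_zero, sub_self] at h2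
    exact h2
  have htop : Tendsto f atTop (𝓝 1) := by
    have h1 : Tendsto (fun y : ℝ => Real.exp ((y + c) / 2)) atTop atTop :=
      Real.tendsto_exp_atTop.comp
        ((tendsto_atTop_add_const_right _ c tendsto_id).atTop_div_const two_pos)
    have h2 := (Real.tendsto_exp_neg_atTop_nhds_zero.comp (h1.const_mul_atTop hK)).const_sub 1
    rw [sub_zero] at h2
    exact h2
  refine ⟨f.measure, f.isProbabilityMeasure hbot htop, fun y => ?_⟩
  have := f.isProbabilityMeasure hbot htop
  rw [cdf_measure_stieltjesFunction f hbot htop]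

/-! ### Limit theorems for the coherence -/

section limits

variable {n p : ℕ} {Ω : Type*} [MeasurableSpace Ω] {μ : Measure Ω} {X : Fin p → Ω → Fin n → ℝ}

lemma HasSphericalColumns.measurable_coherence (hX : HasSphericalColumns μ X) :
    Measurable fun ω => coherence fun j => X j ω :=
  _root_.measurable_coherence.comp (measurable_pi_lambda _ fun j => hX.measurable j)

variable [IsProbabilityMeasure μ]

/-- |ρ| ≥ 1 lies in every event |ρ| ≥ t with t < 1, of probability tending to 0 once n - 1 ≥ 3. This
rules out the default value of `Real.log` at nonpositive arguments, which would break the passage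
from log(1 - L²) to thresholds. -/
lemma HasSphericalColumns.ae_coherence_lt_one (hX : HasSphericalColumns μ X) (hn : 4 ≤ n) :
    ∀ᵐ ω ∂μ, coherence (fun j => X j ω) < 1 := by
  have h : ∀ q : {q : Fin p × Fin p // q.1 < q.2},
      ∀ᵐ ω ∂μ, |pearson (X q.1.1 ω) (X q.1.2 ω)| < 1 := by
    intro q
    rw [ae_iff]
    simp only [not_lt]
    have hlim : Tendsto (fun t => ENNReal.ofReal (capProb (n - 1) t)) (𝓝[<] 1) (𝓝 0) := by
      simpa using ENNReal.tendsto_ofReal (tendsto_capProb_one (d := n - 1) (by omega))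
    refine le_antisymm (ge_of_tendsto hlim ?_) zero_le
    filter_upwards [Ioo_mem_nhdsLT (show (0 : ℝ) < 1 by norm_num)] with t ht
    rw [← hX.measure_pair (by omega) ht.1 ht.2 q.2.ne]
    exact measure_mono fun ω hω => ht.2.le.trans hω
  filter_upwards [ae_all_iff.2 h] with ω hω
  exact (coherence_lt_iff one_pos _).2 hω

end limits

section main

variable {Ω : ℕ → Type*} [∀ n, MeasurableSpace (Ω n)]
  {μ : ∀ n, Measure (Ω n)} [∀ n, IsProbabilityMeasure (μ n)]
  {p : ℕ → ℕ} {X : ∀ n, Fin (p n) → Ω n → Fin n → ℝ} {β : ℝ}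

lemma tendsto_measureReal_coherence_lt_threshold
    (hX : ∀ n, 1 ≤ n → HasSphericalColumns (μ n) (X n)) (hβ : 0 < β)
    (hp : Tendsto (fun n : ℕ => Real.log (p n) / n) atTop (𝓝 β)) (y : ℝ) :
    Tendsto (fun n => (μ n).real {ω | coherence (fun j => X n j ω) < threshold p y n}) atTop
      (𝓝 (Real.exp (-(√(β / (2 * Real.pi * (1 - Real.exp (-4 * β)))) *
        Real.exp ((y + 8 * β) / 2))))) := by
  have h1 := (Real.continuous_exp.tendsto _).comp
    (tendsto_pairs_mul_capProb_threshold hβ hp y).neg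
  have h2 : Tendsto (fun n => (μ n).real {ω | coherence (fun j => X n j ω) < threshold p y n} -
      Real.exp (-((p n * (p n - 1) / 2 : ℝ) * capProb (n - 1) (threshold p y n)))) atTop
      (𝓝 0) := by
    refine squeeze_zero_norm' ?_ (tendsto_cube_mul_capProb_threshold_sq hβ hp y)
    filter_upwards [eventually_ge_atTop 3, eventually_logThreshold_pos hβ hp y] with n hn hs
    obtain ⟨ht0, ht1⟩ := threshold_mem_Ioo hs
    exact (hX n (by omega)).abs_measureReal_coherence_lt_sub_exp_le hn ht0 ht1
  have h := h2.add h1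
  rw [zero_add] at h
  refine h.congr fun n => ?_
  simp

lemma log_one_sub_sq_le_iff {n : ℕ} (hn : 0 < n) {y L : ℝ} (hs : 0 < logThreshold p y n)
    (hL0 : 0 ≤ L) (hL1 : L < 1) :
    n * Real.log (1 - L ^ 2) + 4 * Real.log (p n) - Real.log (Real.log (p n)) ≤ y ↔
      threshold p y n ≤ L := by
  have hn' : (0 : ℝ) < n := by exact_mod_cast hn
  have hpos : 0 < 1 - L ^ 2 := by nlinarith
  have h1 : n * Real.log (1 - L ^ 2) + 4 * Real.log (p n) - Real.log (Real.log (p n)) ≤ y ↔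
      Real.log (1 - L ^ 2) ≤ -logThreshold p y n := by
    rw [logThreshold, ← neg_div, le_div_iff₀ hn']
    constructor <;> intro h <;> linarith
  rw [h1, Real.log_le_iff_le_exp hpos, ← sq_le_sq₀ (threshold_mem_Ioo hs).1.le hL0,
    threshold_sq hs]
  constructor <;> intro h <;> linarith

lemma tendsto_measureReal_log_coherence_le
    (hX : ∀ n, 1 ≤ n → HasSphericalColumns (μ n) (X n)) (hβ : 0 < β)
    (hp : Tendsto (fun n : ℕ => Real.log (p n) / n) atTop (𝓝 β)) (y : ℝ) :
    Tendsto (fun n => (μ n).real {ω | n * Real.log (1 - coherence (fun j => X n j ω) ^ 2)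
      + 4 * Real.log (p n) - Real.log (Real.log (p n)) ≤ y}) atTop
      (𝓝 (1 - Real.exp (-(√(β / (2 * Real.pi * (1 - Real.exp (-4 * β)))) *
        Real.exp ((y + 8 * β) / 2))))) := by
  refine ((tendsto_measureReal_coherence_lt_threshold hX hβ hp y).const_sub 1).congr' ?_
  filter_upwards [eventually_ge_atTop 4, eventually_logThreshold_pos hβ hp y] with n hn hs
  have hXn := hX n (by omega)
  rw [← probReal_compl_eq_one_sub (measurableSet_lt hXn.measurable_coherence measurable_const)]
  refine measureReal_congr ?_
  filter_upwards [hXn.ae_coherence_lt_one hn] with ω hω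
  refine propext ?_
  change ¬ coherence (fun j => X n j ω) < threshold p y n ↔ _
  rw [not_lt]
  exact (log_one_sub_sq_le_iff (by omega) hs (coherence_nonneg _) hω).symm

lemma tendstoInProbability_coherence
    (hX : ∀ n, 1 ≤ n → HasSphericalColumns (μ n) (X n)) (hβ : 0 < β)
    (hp : Tendsto (fun n : ℕ => Real.log (p n) / n) atTop (𝓝 β)) {ν : Measure ℝ}
    (hν : ∀ y : ℝ, cdf ν y = 1 - Real.exp (-(√(β / (2 * Real.pi * (1 - Real.exp (-4 * β)))) *
          Real.exp ((y + 8 * β) / 2)))) :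
    TendstoInProbability μ (fun n ω => coherence (fun j => X n j ω))
      (√(1 - Real.exp (-4 * β))) := by
  intro ε hε
  rw [← ENNReal.tendsto_toReal_zero_iff (fun n => measure_ne_top _ _)]
  refine tendsto_order.2 ⟨fun a ha => Eventually.of_forall fun n =>
    ha.trans_le ENNReal.toReal_nonneg, fun δ hδ => ?_⟩
  -- The limit law gives mass below δ/2 to each of the tails (-∞, y] and (z, ∞), while both
  -- thresholds tend to the same constant.
  obtain ⟨y, hy⟩ := ((tendsto_cdf_atBot ν).eventually_lt_const (half_pos hδ)).exists
  obtain ⟨z, hz⟩ := ((tendsto_cdf_atTop ν).eventually_const_lt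
    (show 1 - δ / 2 < 1 by linarith)).exists
  rw [hν] at hy hz
  have h1 := (tendsto_measureReal_coherence_lt_threshold hX hβ hp y).eventually_const_lt
    (show 1 - δ / 2 < _ by linarith)
  have h2 := (tendsto_measureReal_coherence_lt_threshold hX hβ hp z).eventually_lt_const
    (show _ < δ / 2 by linarith)
  have h3 := (tendsto_threshold hβ hp y).eventually_lt_const (lt_add_of_pos_right _ hε)
  have h4 := (tendsto_threshold hβ hp z).eventually_const_lt (sub_lt_self _ hε)
  filter_upwards [h1, h2, h3, h4, eventually_ge_atTop 1] with n h1 h2 h3 h4 hn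
  have hm := (hX n hn).measurable_coherence
  have hsub : {ω | ε ≤ |coherence (fun j => X n j ω) - √(1 - Real.exp (-4 * β))|} ⊆
      {ω | coherence (fun j => X n j ω) < threshold p y n}ᶜ ∪
        {ω | coherence (fun j => X n j ω) < threshold p z n} := by
    intro ω hω
    rcases le_abs.1 (show ε ≤ |_| from hω) with h | h
    · refine Or.inl (show ¬ coherence (fun j => X n j ω) < threshold p y n from ?_)
      linarith
    · refine Or.inr (show coherence (fun j => X n j ω) < threshold p z n from ?_)
      linarith
  have h5 := (measureReal_mono (μ := μ n) hsub).trans (measureReal_union_le _ _)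
  rw [probReal_compl_eq_one_sub (measurableSet_lt hm measurable_const)] at h5
  rw [measureReal_def] at h5
  linarith

end main

theorem mainTheorem2 {Ω : ℕ → Type*} [∀ n, MeasurableSpace (Ω n)]
    (μ : ∀ n, Measure (Ω n)) [∀ n, IsProbabilityMeasure (μ n)]
    (p : ℕ → ℕ) (X : ∀ n, Fin (p n) → Ω n → Fin n → ℝ)
    (hX : ∀ n, 1 ≤ n → HasSphericalColumns (μ n) (X n))
    (β : ℝ) (hβ : 0 < β)
    (hp : Tendsto (fun n : ℕ => Real.log (p n) / n) atTop (𝓝 β)) :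
    TendstoInProbability μ (fun n ω => coherence (fun j => X n j ω))
      (√(1 - Real.exp (-4 * β))) ∧
    ∃ (ν : Measure ℝ) (_ : IsProbabilityMeasure ν),
      (∀ y : ℝ, cdf ν y =
        1 - Real.exp (-(√(β / (2 * Real.pi * (1 - Real.exp (-4 * β)))) *
          Real.exp ((y + 8 * β) / 2)))) ∧
      TendstoInDistribution
        (fun n ω => n * Real.log (1 - coherence (fun j => X n j ω) ^ 2)
          + 4 * Real.log (p n) - Real.log (Real.log (p n)))
        atTop id μ ν := by
  have hD : 0 < 1 - Real.exp (-4 * β) := by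
    have : Real.exp (-4 * β) < 1 := Real.exp_lt_one_iff.2 (by linarith)
    linarith
  obtain ⟨ν, hν, hcdf⟩ := exists_cdf_eq_one_sub_exp
    (K := √(β / (2 * Real.pi * (1 - Real.exp (-4 * β))))) (Real.sqrt_pos.2 (by positivity)) (8 * β)
  refine ⟨tendstoInProbability_coherence hX hβ hp hcdf, ν, hν, hcdf,
    tendstoInDistribution_of_tendsto_cdf (fun n => ?_) fun y => ?_⟩
  · have hm : AEMeasurable (fun ω => coherence fun j => X n j ω) (μ n) := by
      -- Nothing is assumed at n = 0, but `Fin 0 → ℝ` has a single point, so the coherence is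
      -- constant there.
      rcases Nat.eq_zero_or_pos n with rfl | hn
      · have h : (fun ω => coherence fun j => X 0 j ω) = fun _ =>
            coherence (0 : Fin (p 0) → Fin 0 → ℝ) := by
          ext ω
          congr 1
          exact Subsingleton.elim _ _
        rw [h]
        exact aemeasurable_const
      · exact (hX n hn).measurable_coherence.aemeasurable
    fun_prop
  · rw [hcdf]
    exact tendsto_measureReal_log_coherence_le hX hβ hp y
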